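/- Let $G$ be a discrete subgroup of $PSL_2(\mathbb R)$ acting without fixed points on the hyperbolic plane $\mathbb H$ (for instance the fundamental group of a hyperbolic surface of finite type), and let $F=G\backslash\mathbb H$. For a hyperbolic element $f$ let $A_f$ be its axis and $\tau_f$ its translation number. A hyperbolic $\alpha\in G$ is called a simple closed geodesic if the closed geodesic $\langle\alpha\rangle\backslash A_\alpha\to F$ is injective. For hyperbolic isometries $a,b$ whose axes meet in exactly one point $P$, let $\gamma(a,b):\mathbb R\to\mathbb H$ be the following bi-infinite piecewise geodesic: on $[0,1]$ it is the geodesic arc from $P$ to $aP$ followed by the geodesic arc from $aP$ to $abP$ (each arc parametrized with constant speed, on $[0,\frac12]$ and $[\frac12,1]$ respectively), and $\gamma(a,b)(t+k)=(ab)^k\gamma(a,b)(t)$ for $k\in\mathbb Z$. **Non-cancellation lemma.** For every $L>0$ there is $m_0\in\mathbb N$, depending only on $G$ and $L$, with the following property. Let $\alpha\in G$ be a simple closed geodesic, let $\alpha_1=h\alpha h^{-1}$ for some $h\in G$, and let $\beta,\beta_1\in G$ be hyperbolic elements such that $A_\alpha$ and $A_\beta$ meet in exactly one point, $A_{\alpha_1}$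 and $A_{\beta_1}$ meet in exactly one point, and $\tau_\alpha,\tau_\beta,\tau_{\beta_1}\le L$. If $m>m_0$ is an integer and $\alpha^m\beta=\alpha_1^m\beta_1$, then: 1. $\gamma(\alpha^m,\beta)$ and $\gamma(\alpha_1^m,\beta_1)$ coincide as curves up to a shift of the parameter by an integer, that is, there is $n\in\mathbb Z$ with $\gamma(\alpha_1^m,\beta_1)(t)=\gamma(\alpha^m,\beta)(t+n)$ for all $t\in\mathbb R$ (in particular they have the same image in $\mathbb H$); 2. there is $u\in G$ with $\alpha_1=u\alpha u^{-1}$ and $\beta_1=u\beta u^{-1}$. -/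

import Mathlib

open scoped MatrixGroups UpperHalfPlane OnePoint

noncomputable section

namespace NonCancellation

/-! ### `PSL(2, ℝ)` acting on the hyperbolic plane `ℍ` and on its boundary `ℝ ∪ {∞}` -/

lemma center_le_ker_toPermHom :
    Subgroup.center SL(2, ℝ) ≤ (MulAction.toPermHom SL(2, ℝ) ℍ).ker := by
  intro A hA
  obtain ⟨r, hr, hrA⟩ := Matrix.SpecialLinearGroup.mem_center_iff.mp hA
  have hr2 : r ^ 2 = 1 := by simpa using hr
  have hr0 : (r : ℂ) ≠ 0 := by
    intro h
    have : r = 0 := by exact_mod_cast h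
    simp [this] at hr2
  rw [MonoidHom.mem_ker]
  ext z : 1
  have h00 : A 0 0 = r := by rw [← hrA]; simp
  have h01 : A 0 1 = 0 := by rw [← hrA]; simp
  have h10 : A 1 0 = 0 := by rw [← hrA]; simp
  have h11 : A 1 1 = r := by rw [← hrA]; simp
  apply UpperHalfPlane.ext
  simp only [MulAction.toPermHom_apply, MulAction.toPerm_apply, Equiv.Perm.coe_one, id_eq,
    UpperHalfPlane.coe_specialLinearGroup_apply, h00, h01, h10, h11]
  simp
  field_simp

/-- The action of `PSL(2, ℝ)` on the upper half-plane by Möbius transformations. -/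
instance pslAction : MulAction PSL(2, ℝ) ℍ :=
  MulAction.compHom ℍ
    (QuotientGroup.lift (Subgroup.center SL(2, ℝ)) (MulAction.toPermHom SL(2, ℝ) ℍ)
      center_le_ker_toPermHom)

lemma coe_smul (A : SL(2, ℝ)) (z : ℍ) : (A : PSL(2, ℝ)) • z = A • z := rfl

/-- The action of `PSL(2, ℝ)` on the circle at infinity `∂ℍ = ℝ ∪ {∞}`, identified with the real
projective line. -/
instance pslBoundaryAction : MulAction PSL(2, ℝ) (OnePoint ℝ) :=
  (OnePoint.equivProjectivization ℝ).mulAction PSL(2, ℝ)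

lemma coe_smul_boundary (A : SL(2, ℝ)) (p : OnePoint ℝ) :
    (A : PSL(2, ℝ)) • p = (A : GL (Fin 2) ℝ) • p := rfl

/-- An isometry is hyperbolic if it has exactly two fixed points in `∂ℍ`. -/
def IsHyperbolic (f : PSL(2, ℝ)) : Prop :=
  {p : OnePoint ℝ | f • p = p}.ncard = 2

/-! ### Geodesics, axes, translation numbers -/

/-- The hyperbolic geodesic line with endpoints `p ≠ q` in `∂ℍ`: the half-circle with diameter
`[x, y]` if the endpoints `x, y` are both finite, and a vertical half-line if one of them is `∞`. -/
def geodesicLine (p q : OnePoint ℝ) : Set ℍ :=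
  {z | (∃ x y : ℝ, p = x ∧ q = y ∧ (z.re - x) * (z.re - y) + z.im ^ 2 = 0) ∨
    (∃ x : ℝ, ((p = x ∧ q = ∞) ∨ (p = ∞ ∧ q = x)) ∧ z.re = x)}

/-- The axis `A_f` of a hyperbolic isometry `f`: the geodesic joining its two fixed points. -/
def axis (f : PSL(2, ℝ)) : Set ℍ :=
  {z | ∃ p q : OnePoint ℝ, p ≠ q ∧ f • p = p ∧ f • q = q ∧ z ∈ geodesicLine p q}

/-- The translation number `τ_f` of a hyperbolic isometry `f`: the distance by which `f` translates
its axis (the displacement `dist z (f • z)` is the same at all points `z` of the axis). -/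
def translationNumber (f : PSL(2, ℝ)) : ℝ :=
  ⨅ z : axis f, dist (z : ℍ) (f • (z : ℍ))

/-! ### Geodesic arcs -/

lemma exists_weighted_point (x y : ℍ) (hxy : x ≠ y) (s : ℝ) (hs : s ∈ Set.Icc (0 : ℝ) 1) :
    ∃ z : ℍ, ∀ w : ℍ, Real.sinh (dist x y) * Real.cosh (dist w z) =
      Real.sinh ((1 - s) * dist x y) * Real.cosh (dist w x) +
        Real.sinh (s * dist x y) * Real.cosh (dist w y) := by
  have hd : 0 < dist x y := dist_pos.mpr hxy
  have hc := UpperHalfPlane.cosh_dist' x y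
  set d := dist x y
  have hS : 0 < Real.sinh d := Real.sinh_pos_iff.mpr hd
  obtain ⟨a, ha⟩ : ∃ a, a = Real.sinh ((1 - s) * d) / Real.sinh d := ⟨_, rfl⟩
  obtain ⟨b, hb⟩ : ∃ b, b = Real.sinh (s * d) / Real.sinh d := ⟨_, rfl⟩
  have ha0 : 0 ≤ a := ha ▸ div_nonneg
    (Real.sinh_nonneg_iff.mpr (mul_nonneg (by linarith [hs.2]) hd.le)) hS.le
  have hb0 : 0 ≤ b := hb ▸ div_nonneg
    (Real.sinh_nonneg_iff.mpr (mul_nonneg hs.1 hd.le)) hS.le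
  have hab : a ^ 2 + b ^ 2 + 2 * a * b * Real.cosh d = 1 := by
    rw [ha, hb]
    field_simp
    have e1 : Real.sinh ((1 - s) * d) =
        Real.sinh d * Real.cosh (s * d) - Real.cosh d * Real.sinh (s * d) := by
      rw [← Real.sinh_sub]; ring_nf
    rw [e1]
    linear_combination (Real.sinh d ^ 2) * Real.cosh_sq (s * d)
      - (Real.sinh (s * d) ^ 2) * Real.cosh_sq d
  have hx := x.im_pos
  have hy := y.im_pos
  obtain ⟨D, hD⟩ : ∃ D, D = a / x.im + b / y.im := ⟨_, rfl⟩
  obtain ⟨B, hB⟩ : ∃ B, B = a / x.im * x.re + b / y.im * y.re := ⟨_, rfl⟩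
  have hD0 : 0 < D := by
    have h1 : 0 ≤ a / x.im := div_nonneg ha0 hx.le
    have h2 : 0 ≤ b / y.im := div_nonneg hb0 hy.le
    rcases (hD ▸ add_nonneg h1 h2 : 0 ≤ D).lt_or_eq with h | h
    · exact h
    · exfalso
      have h3 : a / x.im = 0 := by linarith
      have h4 : b / y.im = 0 := by linarith
      have h5 : a = 0 := by simpa [hx.ne'] using h3
      have h6 : b = 0 := by simpa [hy.ne'] using h4
      simp [h5, h6] at hab
  have hAD : (a / x.im * (x.re ^ 2 + x.im ^ 2) + b / y.im * (y.re ^ 2 + y.im ^ 2)) * D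
      = B ^ 2 + 1 := by
    rw [hc] at hab
    rw [← hab, hD, hB]
    field_simp
    ring
  refine ⟨⟨⟨B / D, 1 / D⟩, by simpa using hD0⟩, fun w => ?_⟩
  have hw := w.im_pos
  rw [UpperHalfPlane.cosh_dist', UpperHalfPlane.cosh_dist', UpperHalfPlane.cosh_dist']
  have hA : Real.sinh ((1 - s) * d) = a * Real.sinh d := by rw [ha]; field_simp
  have hB' : Real.sinh (s * d) = b * Real.sinh d := by rw [hb]; field_simp
  rw [hA, hB']
  have : ((w.re - B / D) ^ 2 + w.im ^ 2 + (1 / D) ^ 2) / (2 * w.im * (1 / D)) =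
      a * (((w.re - x.re) ^ 2 + w.im ^ 2 + x.im ^ 2) / (2 * w.im * x.im)) +
      b * (((w.re - y.re) ^ 2 + w.im ^ 2 + y.im ^ 2) / (2 * w.im * y.im)) := by
    have e : ((w.re - B / D) ^ 2 + w.im ^ 2 + (1 / D) ^ 2) / (2 * w.im * (1 / D)) =
      (D * (w.re ^ 2 + w.im ^ 2) - 2 * B * w.re + (B ^ 2 + 1) / D) / (2 * w.im) := by
      field_simp
      ring
    rw [e, ← hAD, mul_div_cancel_right₀ _ hD0.ne', hD, hB]
    field_simp
    ring
  change Real.sinh d * (((w.re - B / D) ^ 2 + w.im ^ 2 + (1 / D) ^ 2) / (2 * w.im * (1 / D))) = _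
  rw [this]
  ring

/-- In `ℍ` there is a unique point at any given proportion of the way from `x` to `y`. -/
lemma existsUnique_geodesicPoint (x y : ℍ) (s : ℝ) (hs : s ∈ Set.Icc (0 : ℝ) 1) :
    ∃! z : ℍ, dist x z = s * dist x y ∧ dist z y = (1 - s) * dist x y := by
  rcases eq_or_ne x y with rfl | hxy
  · exact ⟨x, by simp, fun z hz => by simpa [eq_comm] using hz.1⟩
  · obtain ⟨z, hz⟩ := exists_weighted_point x y hxy s hs
    have hd : 0 < dist x y := dist_pos.mpr hxy
    have hS : Real.sinh (dist x y) ≠ 0 := (Real.sinh_pos_iff.mpr hd).ne'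
    have e1 : Real.sinh ((1 - s) * dist x y) = Real.sinh (dist x y) * Real.cosh (s * dist x y)
        - Real.cosh (dist x y) * Real.sinh (s * dist x y) := by
      rw [← Real.sinh_sub]; ring_nf
    have e2 : Real.cosh ((1 - s) * dist x y) = Real.cosh (dist x y) * Real.cosh (s * dist x y)
        - Real.sinh (dist x y) * Real.sinh (s * dist x y) := by
      rw [← Real.cosh_sub]; ring_nf
    have hs0 : 0 ≤ s * dist x y := mul_nonneg hs.1 hd.le
    have hs1 : 0 ≤ (1 - s) * dist x y := mul_nonneg (by linarith [hs.2]) hd.le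
    have key : ∀ {u v : ℝ}, 0 ≤ u → 0 ≤ v → Real.cosh u = Real.cosh v → u = v := by
      intro u v hu hv h
      exact Real.cosh_strictMonoOn.injOn hu hv h
    refine ⟨z, ⟨key dist_nonneg hs0 ?_, key dist_nonneg hs1 ?_⟩, ?_⟩
    · have h := hz x
      rw [dist_self, Real.cosh_zero, e1] at h
      apply mul_left_cancel₀ hS
      linear_combination h
    · have h := hz y
      rw [dist_self, Real.cosh_zero, dist_comm y x, e1, dist_comm y z] at h
      apply mul_left_cancel₀ hS
      rw [e2]
      linear_combination h - Real.sinh (s * dist x y) * Real.cosh_sq (dist x y)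
    · rintro w ⟨h1, h2⟩
      have h := hz w
      rw [dist_comm w x, h1, h2, e1, e2] at h
      have : dist w z = 0 := by
        apply key dist_nonneg le_rfl
        rw [Real.cosh_zero]
        apply mul_left_cancel₀ hS
        linear_combination h + Real.sinh (dist x y) * Real.cosh_sq (s * dist x y)
      exact dist_eq_zero.mp this

/-- The constant speed parametrization `s ↦ geodesicArc x y s`, `0 ≤ s ≤ 1`, of the geodesic arc
from `x` to `y` (only meaningful for `0 ≤ s ≤ 1`). -/
def geodesicArc (x y : ℍ) (s : ℝ) : ℍ :=
  Classical.epsilon fun z => dist x z = s * dist x y ∧ dist z y = (1 - s) * dist x y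

lemma geodesicArc_spec (x y : ℍ) (s : ℝ) (hs : s ∈ Set.Icc (0 : ℝ) 1) :
    dist x (geodesicArc x y s) = s * dist x y ∧
      dist (geodesicArc x y s) y = (1 - s) * dist x y :=
  Classical.epsilon_spec (existsUnique_geodesicPoint x y s hs).exists

/-- One period `[0, 1] → ℍ`: the geodesic arc from `P` to `a P` followed by the geodesic arc from
`a P` to `(a b) P`. -/
def onePeriod (a b : PSL(2, ℝ)) (P : ℍ) (s : ℝ) : ℍ :=
  if s ≤ 1 / 2 then geodesicArc P (a • P) (2 * s)
  else geodesicArc (a • P) ((a * b) • P) (2 * s - 1)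

/-- The bi-infinite piecewise geodesic `γ(a, b) : ℝ → ℍ`, where `P` is the intersection point of the
axes of `a` and `b`: the extension of `onePeriod a b P` with
`γ(a, b)(t + k) = (a b) ^ k • γ(a, b)(t)` for `k ∈ ℤ`. -/
def piecewiseGeodesic (a b : PSL(2, ℝ)) (P : ℍ) (t : ℝ) : ℍ :=
  (a * b) ^ ⌊t⌋ • onePeriod a b P (Int.fract t)

/-! ### Surface groups and simple closed geodesics -/

/-- `G` is a discrete subgroup of `PSL(2, ℝ)` acting on `ℍ` without fixed points, so that `G \ ℍ` is
a hyperbolic surface with fundamental group `G`. -/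
structure IsSurfaceGroup (G : Subgroup PSL(2, ℝ)) : Prop where
  discrete : DiscreteTopology G
  free : ∀ g ∈ G, ∀ z : ℍ, g • z = z → g = 1

/-- The closed geodesic of `G \ ℍ` given by a hyperbolic `a ∈ G` is the map
`⟨a⟩ \ A_a → G \ ℍ` induced by the inclusion of the axis. It is simple if this map is injective. -/
def IsSimpleClosedGeodesic (G : Subgroup PSL(2, ℝ)) (a : PSL(2, ℝ)) : Prop :=
  a ∈ G ∧ IsHyperbolic a ∧
    ∀ g ∈ G, ∀ z ∈ axis a, g • z ∈ axis a → ∃ n : ℤ, g • z = a ^ n • z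

end NonCancellation

end

noncomputable section

namespace NonCancellation

/-! ### Points of `ℍ` as trace-free matrices -/

/-- The trace-free matrix `J` with `J ^ 2 = -1` whose Möbius fixed point is `z`. -/
def pointMatrix (z : ℍ) : Matrix (Fin 2) (Fin 2) ℝ :=
  !![z.re / z.im, -(z.re ^ 2 + z.im ^ 2) / z.im; 1 / z.im, -z.re / z.im]

lemma sl_smul_re_im (A : SL(2, ℝ)) (z : ℍ) :
    (A • z).re = ((A 0 0 * z.re + A 0 1) * (A 1 0 * z.re + A 1 1) + A 0 0 * A 1 0 * z.im ^ 2) /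
        ((A 1 0 * z.re + A 1 1) ^ 2 + (A 1 0 * z.im) ^ 2) ∧
      (A • z).im = z.im / ((A 1 0 * z.re + A 1 1) ^ 2 + (A 1 0 * z.im) ^ 2) := by
  have h := UpperHalfPlane.coe_specialLinearGroup_apply A z
  have hdet : A 0 0 * A 1 1 - A 0 1 * A 1 0 = 1 := by
    rw [← Matrix.det_fin_two]; exact A.2
  have hN : Complex.normSq ((A 1 0 : ℂ) * z + A 1 1) =
      (A 1 0 * z.re + A 1 1) ^ 2 + (A 1 0 * z.im) ^ 2 := by
    simp [Complex.normSq_apply]; ring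
  constructor
  · have := congrArg Complex.re h
    rw [Complex.div_re] at this
    simp only [Algebra.algebraMap_self, RingHom.id_apply] at this
    rw [hN] at this
    simp only [UpperHalfPlane.coe_re] at this
    rw [this, ← add_div]
    simp
    ring
  · have := congrArg Complex.im h
    rw [Complex.div_im] at this
    simp only [Algebra.algebraMap_self, RingHom.id_apply] at this
    rw [hN] at this
    simp only [UpperHalfPlane.coe_im] at this
    rw [this, ← sub_div]
    simp
    congr 1
    linear_combination z.im * hdet

lemma pointMatrix_smul_mul (A : SL(2, ℝ)) (z : ℍ) :
    pointMatrix (A • z) * A.1 = A.1 * pointMatrix z := by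
  obtain ⟨h1, h2⟩ := sl_smul_re_im A z
  have hdet : A 0 0 * A 1 1 - A 0 1 * A 1 0 = 1 := by
    rw [← Matrix.det_fin_two]; exact A.2
  have hy := z.im_pos
  have hD : 0 < (A 1 0 * z.re + A 1 1) ^ 2 + (A 1 0 * z.im) ^ 2 := by
    have := (A • z).im_pos
    rw [h2] at this
    exact (div_pos_iff_of_pos_left hy).mp this
  have hJ : pointMatrix (A • z) = !![((A 0 0 * z.re + A 0 1) * (A 1 0 * z.re + A 1 1) +
      A 0 0 * A 1 0 * z.im ^ 2) / z.im, -((A 0 0 * z.re + A 0 1) ^ 2 + (A 0 0 * z.im) ^ 2) / z.im;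
      ((A 1 0 * z.re + A 1 1) ^ 2 + (A 1 0 * z.im) ^ 2) / z.im,
      -((A 0 0 * z.re + A 0 1) * (A 1 0 * z.re + A 1 1) + A 0 0 * A 1 0 * z.im ^ 2) / z.im] := by
    have hRS : ((A 0 0 * z.re + A 0 1) * (A 1 0 * z.re + A 1 1) + A 0 0 * A 1 0 * z.im ^ 2) ^ 2 +
        z.im ^ 2 = ((A 0 0 * z.re + A 0 1) ^ 2 + (A 0 0 * z.im) ^ 2) *
          ((A 1 0 * z.re + A 1 1) ^ 2 + (A 1 0 * z.im) ^ 2) := by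
      linear_combination (-(A 0 0 * A 1 1 - A 0 1 * A 1 0 + 1) * z.im ^ 2) * hdet
    rw [pointMatrix, h1, h2]
    generalize (A 1 0 * z.re + A 1 1) ^ 2 + (A 1 0 * z.im) ^ 2 = D at *
    generalize (A 0 0 * z.re + A 0 1) * (A 1 0 * z.re + A 1 1) + A 0 0 * A 1 0 * z.im ^ 2 = R at *
    generalize (A 0 0 * z.re + A 0 1) ^ 2 + (A 0 0 * z.im) ^ 2 = S at *
    have e : -((R / D) ^ 2 + (z.im / D) ^ 2) / (z.im / D) = -S / z.im := by
      field_simp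
      linear_combination -hRS
    rw [e]
    congr 1
    ext i j
    fin_cases i <;> fin_cases j <;> simp <;> field_simp
  rw [hJ, pointMatrix]
  have hA : A.1 = !![A 0 0, A 0 1; A 1 0, A 1 1] := Matrix.eta_fin_two A.1
  rw [hA, Matrix.mul_fin_two, Matrix.mul_fin_two]
  generalize A 0 0 = a at *
  generalize A 0 1 = b at *
  generalize A 1 0 = c at *
  generalize A 1 1 = d at *
  ext i j
  fin_cases i <;> fin_cases j <;> simp <;> field_simp
  · linear_combination (a * z.re + b) * hdet
  · linear_combination -(b * z.re + a * (z.re ^ 2 + z.im ^ 2)) * hdet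
  · linear_combination (c * z.re + d) * hdet
  · linear_combination -(c * (z.re ^ 2 + z.im ^ 2) + d * z.re) * hdet

lemma trace_pointMatrix (z : ℍ) : (pointMatrix z).trace = 0 := by
  simp [pointMatrix, Matrix.trace_fin_two]; ring

lemma pointMatrix_mul_self (z : ℍ) : pointMatrix z * pointMatrix z = -1 := by
  have := z.im_ne_zero
  rw [pointMatrix, Matrix.mul_fin_two]
  ext i j
  fin_cases i <;> fin_cases j <;> simp <;> field_simp <;> ring

lemma pointMatrix_injective : Function.Injective pointMatrix := by
  intro z w h
  have h1 := congrFun (congrFun h 1) 0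
  have h0 := congrFun (congrFun h 0) 0
  simp only [pointMatrix] at h0 h1
  simp at h0 h1
  have hi : z.im = w.im := h1
  rw [hi] at h0
  have := w.im_ne_zero
  have hr : z.re = w.re := by field_simp at h0; exact h0
  exact UpperHalfPlane.ext_re_im hr hi

lemma cosh_dist_eq_trace (z w : ℍ) :
    Real.cosh (dist z w) = -(pointMatrix z * pointMatrix w).trace / 2 := by
  have := z.im_ne_zero
  have := w.im_ne_zero
  rw [UpperHalfPlane.cosh_dist', pointMatrix, pointMatrix, Matrix.mul_fin_two]
  simp [Matrix.trace_fin_two]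
  field_simp
  ring

lemma conj_pointMatrix (A : SL(2, ℝ)) (z : ℍ) :
    pointMatrix (A • z) = A.1 * pointMatrix z * (A⁻¹).1 := by
  rw [← pointMatrix_smul_mul, Matrix.mul_assoc, ← Matrix.SpecialLinearGroup.coe_mul]
  simp

/-- A trace-free matrix with negative square is a multiple of a `pointMatrix`. -/
lemma exists_pointMatrix_eq_smul (M : Matrix (Fin 2) (Fin 2) ℝ) (h0 : M.trace = 0)
    (hM : 0 < M.det) : ∃ z : ℍ, ∃ c : ℝ, pointMatrix z = c • M := by
  rw [Matrix.trace_fin_two] at h0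
  rw [Matrix.det_fin_two] at hM
  have h11 : M 1 1 = -M 0 0 := by linarith
  rw [h11] at hM
  have hne : M 1 0 ≠ 0 := by
    intro h; rw [h] at hM; nlinarith [sq_nonneg (M 0 0)]
  obtain ⟨r, hr⟩ : ∃ r, r = Real.sqrt (M 0 0 * -M 0 0 - M 0 1 * M 1 0) := ⟨_, rfl⟩
  have hr0 : 0 < r := hr ▸ Real.sqrt_pos.mpr hM
  have hr2 : r ^ 2 = M 0 0 * -M 0 0 - M 0 1 * M 1 0 := by rw [hr, Real.sq_sqrt hM.le]
  refine ⟨⟨⟨M 0 0 / M 1 0, r / |M 1 0|⟩, by simp; positivity⟩, |M 1 0| / M 1 0 / r, ?_⟩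
  have e : ((⟨⟨M 0 0 / M 1 0, r / |M 1 0|⟩, by simp; positivity⟩ : ℍ)).re = M 0 0 / M 1 0 := rfl
  have e' : ((⟨⟨M 0 0 / M 1 0, r / |M 1 0|⟩, by simp; positivity⟩ : ℍ)).im = r / |M 1 0| := rfl
  rw [pointMatrix, e, e']
  have ha := abs_pos.mpr hne
  have hs := sq_abs (M 1 0)
  rw [Matrix.eta_fin_two M, h11]
  generalize M 0 0 = p at *
  generalize M 0 1 = q at *
  generalize M 1 0 = t at *
  ext i j
  fin_cases i <;> fin_cases j <;> simp <;> field_simp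
  rw [hs]
  linear_combination -t ^ 2 * hr2

/-! ### Signed distance to a line -/

/-- For a trace-free matrix `N` with `N ^ 2 = 1`, the hyperbolic sine of the signed distance from
`z` to the line of zeros of this function. -/
def lineFun (N : Matrix (Fin 2) (Fin 2) ℝ) (z : ℍ) : ℝ := -(N * pointMatrix z).trace / 2

/-- The unit vectors of the trace form, that is, the oriented lines of `ℍ`. -/
def IsLine (N : Matrix (Fin 2) (Fin 2) ℝ) : Prop := N.trace = 0 ∧ N * N = 1

lemma IsLine.neg {N : Matrix (Fin 2) (Fin 2) ℝ} (h : IsLine N) : IsLine (-N) :=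
  ⟨by simp [h.1], by simp [h.2]⟩

lemma lineFun_neg (N : Matrix (Fin 2) (Fin 2) ℝ) (z : ℍ) : lineFun (-N) z = -lineFun N z := by
  simp [lineFun]; ring

lemma IsLine.conj {N : Matrix (Fin 2) (Fin 2) ℝ} (h : IsLine N) (A : SL(2, ℝ)) :
    IsLine (A.1 * N * (A⁻¹).1) := by
  have e : (A⁻¹).1 * A.1 = 1 := by rw [← Matrix.SpecialLinearGroup.coe_mul]; simp
  have e' : A.1 * (A⁻¹).1 = 1 := by rw [← Matrix.SpecialLinearGroup.coe_mul]; simp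
  constructor
  · rw [Matrix.trace_mul_comm, ← Matrix.mul_assoc, e, Matrix.one_mul, h.1]
  · calc A.1 * N * (A⁻¹).1 * (A.1 * N * (A⁻¹).1) = A.1 * (N * ((A⁻¹).1 * A.1) * N) * (A⁻¹).1 := by
          simp only [Matrix.mul_assoc]
      _ = 1 := by rw [e, Matrix.mul_one, h.2, Matrix.mul_one, e']

lemma lineFun_conj (N : Matrix (Fin 2) (Fin 2) ℝ) (A : SL(2, ℝ)) (z : ℍ) :
    lineFun (A.1 * N * (A⁻¹).1) (A • z) = lineFun N z := by
  have e : (A⁻¹).1 * A.1 = 1 := by rw [← Matrix.SpecialLinearGroup.coe_mul]; simp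
  rw [lineFun, lineFun, conj_pointMatrix]
  have : A.1 * N * (A⁻¹).1 * (A.1 * pointMatrix z * (A⁻¹).1) =
      A.1 * (N * ((A⁻¹).1 * A.1) * pointMatrix z * (A⁻¹).1) := by simp only [Matrix.mul_assoc]
  rw [this, e, Matrix.mul_one, Matrix.trace_mul_comm, Matrix.mul_assoc, e, Matrix.mul_one]

lemma lineFun_conj_inv (N : Matrix (Fin 2) (Fin 2) ℝ) (A : SL(2, ℝ)) (z : ℍ) :
    lineFun (A.1 * N * (A⁻¹).1) z = lineFun N (A⁻¹ • z) := by
  rw [← lineFun_conj N A, smul_inv_smul]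

lemma lineFun_eq (N : Matrix (Fin 2) (Fin 2) ℝ) (h : N.trace = 0) (z : ℍ) :
    lineFun N z = (N 1 0 * (z.re ^ 2 + z.im ^ 2) - 2 * N 0 0 * z.re - N 0 1) / (2 * z.im) := by
  have := z.im_ne_zero
  rw [Matrix.trace_fin_two] at h
  have h11 : N 1 1 = -N 0 0 := by linarith
  rw [lineFun, pointMatrix, Matrix.eta_fin_two N, Matrix.mul_fin_two, h11]
  simp [Matrix.trace_fin_two]
  field_simp
  ring

lemma IsLine.entries {N : Matrix (Fin 2) (Fin 2) ℝ} (h : IsLine N) :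
    N 1 1 = -N 0 0 ∧ N 0 0 ^ 2 + N 0 1 * N 1 0 = 1 := by
  have h1 := h.1
  rw [Matrix.trace_fin_two] at h1
  have h2 := congrFun (congrFun h.2 0) 0
  rw [Matrix.mul_apply, Fin.sum_univ_two] at h2
  simp at h2
  exact ⟨by linarith, by linarith⟩

/-- The product of two lines for the trace form. -/
def lineProd (N N' : Matrix (Fin 2) (Fin 2) ℝ) : ℝ := (N * N').trace / 2

lemma IsLine.lineProd_eq {N N' : Matrix (Fin 2) (Fin 2) ℝ} (h : IsLine N) (h' : IsLine N') :
    lineProd N N' = N 0 0 * N' 0 0 + (N 0 1 * N' 1 0 + N 1 0 * N' 0 1) / 2 := by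
  rw [lineProd, Matrix.trace_fin_two, Matrix.mul_apply, Matrix.mul_apply, Fin.sum_univ_two,
    Fin.sum_univ_two, h.entries.1, h'.entries.1]
  ring

lemma sq_lineFun_ge {N N' : Matrix (Fin 2) (Fin 2) ℝ} (h : IsLine N) (h' : IsLine N') {z : ℍ}
    (hz : lineFun N z = 0) : lineProd N N' ^ 2 - 1 ≤ lineFun N' z ^ 2 := by
  have hy := z.im_ne_zero
  rw [h.lineProd_eq h', lineFun_eq _ h'.1]
  rw [lineFun_eq _ h.1] at hz
  obtain ⟨-, hN⟩ := h.entries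
  obtain ⟨-, hN'⟩ := h'.entries
  generalize N 0 0 = p at *
  generalize N 0 1 = r at *
  generalize N 1 0 = t at *
  generalize N' 0 0 = p' at *
  generalize N' 0 1 = r' at *
  generalize N' 1 0 = t' at *
  generalize z.re = x at *
  generalize z.im = y at *
  have hz' : r = t * (x ^ 2 + y ^ 2) - 2 * p * x := by
    field_simp at hz; linarith
  obtain ⟨q, hq⟩ : ∃ q, q = p - x * t := ⟨_, rfl⟩
  obtain ⟨q', hq'⟩ : ∃ q', q' = p' - x * t' := ⟨_, rfl⟩
  obtain ⟨s, hs⟩ : ∃ s, s = t * y := ⟨_, rfl⟩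
  obtain ⟨a, ha⟩ : ∃ a, a = (t' * y + (r' + 2 * x * p' - x ^ 2 * t') / y) / 2 := ⟨_, rfl⟩
  obtain ⟨b, hb⟩ : ∃ b, b = (t' * (x ^ 2 + y ^ 2) - 2 * p' * x - r') / (2 * y) := ⟨_, rfl⟩
  have e1 : q ^ 2 + s ^ 2 = 1 := by
    rw [← hN, hz', hq, hs]; ring
  have e2 : q' ^ 2 + a ^ 2 - b ^ 2 = 1 := by
    rw [← hN', hq', ha, hb]; field_simp; ring
  have e3 : p * p' + (r * t' + t * r') / 2 = q * q' + s * a := by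
    rw [hq, hq', hs, ha, hz']; field_simp; ring
  rw [e3, ← hb]
  nlinarith [sq_nonneg (q * a - s * q')]

lemma sq_lineFun_le {N : Matrix (Fin 2) (Fin 2) ℝ} (h : IsLine N) {z : ℍ} (w : ℍ)
    (hz : lineFun N z = 0) : lineFun N w ^ 2 ≤ Real.sinh (dist w z) ^ 2 := by
  have hy := z.im_ne_zero
  have hv := w.im_ne_zero
  rw [Real.sinh_sq, UpperHalfPlane.cosh_dist', lineFun_eq _ h.1]
  rw [lineFun_eq _ h.1] at hz
  obtain ⟨-, hN⟩ := h.entries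
  generalize N 0 0 = p at *
  generalize N 0 1 = r at *
  generalize N 1 0 = t at *
  generalize z.re = x at *
  generalize z.im = y at *
  generalize w.re = u at *
  generalize w.im = v at *
  have hz' : r = t * (x ^ 2 + y ^ 2) - 2 * p * x := by
    field_simp at hz; linarith
  obtain ⟨q, hq⟩ : ∃ q, q = p - x * t := ⟨_, rfl⟩
  obtain ⟨s, hs⟩ : ∃ s, s = t * y := ⟨_, rfl⟩
  have e1 : q ^ 2 + s ^ 2 = 1 := by
    rw [← hN, hz', hq, hs]; ring
  obtain ⟨a, ha⟩ : ∃ a, a = ((u - x) ^ 2 + v ^ 2 - y ^ 2) / (2 * v * y) := ⟨_, rfl⟩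
  obtain ⟨b, hb⟩ : ∃ b, b = (u - x) / v := ⟨_, rfl⟩
  have e2 : (t * (u ^ 2 + v ^ 2) - 2 * p * u - r) / (2 * v) = s * a - q * b := by
    rw [hz', hq, hs, ha, hb]; field_simp; ring
  have e3 : (((u - x) ^ 2 + v ^ 2 + y ^ 2) / (2 * v * y)) ^ 2 - 1 = a ^ 2 + b ^ 2 := by
    rw [ha, hb]; field_simp; ring
  rw [e2, e3]
  nlinarith [sq_nonneg (q * a + s * b)]

/-! ### Geodesic arcs and lines -/

lemma lineFun_eq_cosh_combination {N : Matrix (Fin 2) (Fin 2) ℝ} (h : N.trace = 0) :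
    ∃ (a b c : ℝ) (u v w : ℍ), ∀ z, lineFun N z =
      a * Real.cosh (dist u z) + b * Real.cosh (dist v z) + c * Real.cosh (dist w z) := by
  refine ⟨4 / 3 * N 1 0 - 2 / 3 * N 0 0 + N 0 1 / 3, -2 / 3 * (N 1 0 + N 0 0 + N 0 1), N 0 0,
    ⟨⟨0, 1⟩, by simp⟩, ⟨⟨0, 2⟩, by simp⟩, ⟨⟨1, 1⟩, by simp⟩, fun z => ?_⟩
  have := z.im_ne_zero
  rw [lineFun_eq N h, UpperHalfPlane.cosh_dist', UpperHalfPlane.cosh_dist',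
    UpperHalfPlane.cosh_dist']
  change _ = _ * (((0 - z.re) ^ 2 + 1 ^ 2 + z.im ^ 2) / (2 * 1 * z.im)) +
    _ * (((0 - z.re) ^ 2 + 2 ^ 2 + z.im ^ 2) / (2 * 2 * z.im)) +
    _ * (((1 - z.re) ^ 2 + 1 ^ 2 + z.im ^ 2) / (2 * 1 * z.im))
  field_simp
  ring

lemma sinh_mul_lineFun_geodesicArc {N : Matrix (Fin 2) (Fin 2) ℝ} (h : N.trace = 0) {x y : ℍ}
    (hxy : x ≠ y) {s : ℝ} (hs : s ∈ Set.Icc (0 : ℝ) 1) :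
    Real.sinh (dist x y) * lineFun N (geodesicArc x y s) =
      Real.sinh ((1 - s) * dist x y) * lineFun N x + Real.sinh (s * dist x y) * lineFun N y := by
  obtain ⟨z, hz⟩ := exists_weighted_point x y hxy s hs
  have hS : Real.sinh (dist x y) ≠ 0 := (Real.sinh_pos_iff.mpr (dist_pos.mpr hxy)).ne'
  have hz' : geodesicArc x y s = z := by
    obtain ⟨h1, h2⟩ := geodesicArc_spec x y s hs
    have h3 := hz (geodesicArc x y s)
    rw [dist_comm _ x, h1, h2, add_comm, mul_comm, mul_comm (Real.sinh ((1 - s) * _)),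
      ← Real.sinh_add, ← add_mul, add_sub_cancel, one_mul] at h3
    have h4 : Real.cosh (dist (geodesicArc x y s) z) = 1 := by
      apply mul_right_cancel₀ hS
      rw [h3, one_mul]
    by_contra hne
    exact (Real.one_lt_cosh.mpr (dist_ne_zero.mpr hne)).ne' h4
  rw [hz']
  obtain ⟨a, b, c, u, v, w, hN⟩ := lineFun_eq_cosh_combination h
  rw [hN, hN, hN]
  linear_combination a * hz u + b * hz v + c * hz w

lemma exists_crossing {N : Matrix (Fin 2) (Fin 2) ℝ} (h : N.trace = 0) {x y : ℍ}
    (hx : lineFun N x ≤ 0) (hy : 0 ≤ lineFun N y) :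
    ∃ v, lineFun N v = 0 ∧ dist x v + dist v y = dist x y ∧
      ∃ a b : ℝ, 0 ≤ a ∧ 0 ≤ b ∧ ∀ N' : Matrix (Fin 2) (Fin 2) ℝ, N'.trace = 0 →
        lineFun N' v = a * lineFun N' x + b * lineFun N' y := by
  rcases eq_or_ne x y with rfl | hxy
  · exact ⟨x, le_antisymm hx hy, by simp, 1, 0, by simp⟩
  have hd := dist_pos.mpr hxy
  have hS : 0 < Real.sinh (dist x y) := Real.sinh_pos_iff.mpr hd
  obtain ⟨s, hs, hs0⟩ : ∃ s ∈ Set.Icc (0 : ℝ) 1, Real.sinh ((1 - s) * dist x y) * lineFun N x +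
      Real.sinh (s * dist x y) * lineFun N y = 0 := by
    have hc : Continuous fun s : ℝ => Real.sinh ((1 - s) * dist x y) * lineFun N x +
      Real.sinh (s * dist x y) * lineFun N y := by
      have := Real.continuous_sinh
      fun_prop
    have := intermediate_value_Icc zero_le_one hc.continuousOn
    refine this ⟨?_, ?_⟩
    · simpa using mul_nonpos_of_nonneg_of_nonpos hS.le hx
    · simpa using mul_nonneg hS.le hy
  have key : ∀ N' : Matrix (Fin 2) (Fin 2) ℝ, N'.trace = 0 → lineFun N' (geodesicArc x y s) =
      Real.sinh ((1 - s) * dist x y) / Real.sinh (dist x y) * lineFun N' x +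
        Real.sinh (s * dist x y) / Real.sinh (dist x y) * lineFun N' y := by
    intro N' hN'
    apply mul_left_cancel₀ hS.ne'
    rw [sinh_mul_lineFun_geodesicArc hN' hxy hs]
    field_simp
  obtain ⟨h1, h2⟩ := geodesicArc_spec x y s hs
  refine ⟨geodesicArc x y s, ?_, by rw [h1, h2]; ring, _, _, ?_, ?_, key⟩
  · have := sinh_mul_lineFun_geodesicArc h hxy hs
    rw [hs0] at this
    exact (mul_eq_zero.mp this).resolve_left hS.ne'
  · exact div_nonneg (Real.sinh_nonneg_iff.mpr (mul_nonneg (by linarith [hs.2]) hd.le)) hS.le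
  · exact div_nonneg (Real.sinh_nonneg_iff.mpr (mul_nonneg hs.1 hd.le)) hS.le

lemma sq_lineProd_le {N N' : Matrix (Fin 2) (Fin 2) ℝ} (h : IsLine N) (h' : IsLine N') {x x' : ℍ}
    (hx : lineFun N x = 0) (hx' : lineFun N' x' = 0) :
    lineProd N N' ^ 2 ≤ Real.cosh (dist x x') ^ 2 := by
  have h1 := sq_lineFun_ge h h' hx
  have h2 := sq_lineFun_le h' x hx'
  rw [Real.sinh_sq] at h2
  linarith

/-- Two lines that stay close to each other along a long segment are almost equal. -/
lemma lineProd_fellow_travel {N N' : Matrix (Fin 2) (Fin 2) ℝ} (h : IsLine N) (h' : IsLine N')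
    {x y x' y' : ℍ} {K : ℝ} (hx : lineFun N x = 0) (hy : lineFun N y = 0)
    (hx' : lineFun N' x' = 0) (hy' : lineFun N' y' = 0) (hxx : dist x x' ≤ K)
    (hyy : dist y y' ≤ K) :
    (lineProd N N' ^ 2 - 1) * Real.cosh (dist x y / 2) ^ 2 ≤ Real.sinh K ^ 2 := by
  have bound : ∀ z z' : ℍ, lineFun N' z' = 0 → dist z z' ≤ K → |lineFun N' z| ≤ Real.sinh K := by
    intro z z' hz' hzz
    have h1 : 0 ≤ Real.sinh (dist z z') := Real.sinh_nonneg_iff.mpr dist_nonneg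
    have := abs_le_of_sq_le_sq' (sq_lineFun_le h' z hz') h1
    exact (abs_le.mpr this).trans (Real.sinh_le_sinh.mpr hzz)
  have bx := bound x x' hx' hxx
  have bY := bound y y' hy' hyy
  rcases eq_or_ne x y with rfl | hxy
  · have h1 := sq_lineFun_ge h h' hx
    have : lineFun N' x ^ 2 ≤ Real.sinh K ^ 2 := sq_le_sq' (abs_le.mp bx).1 (abs_le.mp bx).2
    simp only [dist_self, zero_div, Real.cosh_zero]
    linarith
  have hs : (1 / 2 : ℝ) ∈ Set.Icc (0 : ℝ) 1 := by norm_num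
  obtain ⟨d, hd⟩ : ∃ d, d = dist x y / 2 := ⟨_, rfl⟩
  have hd0 : 0 < d := by rw [hd]; exact half_pos (dist_pos.mpr hxy)
  have hS : 0 < Real.sinh d := Real.sinh_pos_iff.mpr hd0
  have hC : 0 < Real.cosh d := Real.cosh_pos d
  have key : ∀ N' : Matrix (Fin 2) (Fin 2) ℝ, N'.trace = 0 →
      2 * Real.cosh d * lineFun N' (geodesicArc x y (1 / 2)) = lineFun N' x + lineFun N' y := by
    intro N' hN'
    have := sinh_mul_lineFun_geodesicArc hN' hxy hs
    have e1 : (1 - 1 / 2) * dist x y = d := by rw [hd]; ring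
    have e2 : 1 / 2 * dist x y = d := by rw [hd]; ring
    have e3 : dist x y = 2 * d := by rw [hd]; ring
    rw [e1, e2, e3, Real.sinh_two_mul] at this
    apply mul_left_cancel₀ hS.ne'
    linear_combination this
  have k1 := key N h.1
  rw [hx, hy, add_zero] at k1
  have k1' := (mul_eq_zero.mp k1).resolve_left (by positivity)
  have k2 := key N' h'.1
  have h1 := sq_lineFun_ge h h' k1'
  rw [← hd]
  have k3 : Real.cosh d * |lineFun N' (geodesicArc x y (1 / 2))| ≤ Real.sinh K := by
    have : |2 * Real.cosh d * lineFun N' (geodesicArc x y (1 / 2))| ≤ 2 * Real.sinh K := by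
      rw [k2]
      exact (abs_add_le _ _).trans (by linarith)
    rw [abs_mul, abs_of_pos (by positivity)] at this
    linarith
  calc (lineProd N N' ^ 2 - 1) * Real.cosh d ^ 2
      ≤ lineFun N' (geodesicArc x y (1 / 2)) ^ 2 * Real.cosh d ^ 2 := by gcongr
    _ = (Real.cosh d * |lineFun N' (geodesicArc x y (1 / 2))|) ^ 2 := by
        rw [mul_pow, sq_abs]; ring
    _ ≤ _ := by gcongr

lemma lineFun_pointMatrix {z : ℍ} {c : ℝ} {M : Matrix (Fin 2) (Fin 2) ℝ}
    (h : pointMatrix z = c • M) (N : Matrix (Fin 2) (Fin 2) ℝ) :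
    lineFun N z = -c * (N * M).trace / 2 := by
  rw [lineFun, h, Matrix.mul_smul, Matrix.trace_smul, smul_eq_mul]
  ring

lemma exists_meet {N N' : Matrix (Fin 2) (Fin 2) ℝ} (h : IsLine N) (h' : IsLine N')
    (hp : lineProd N N' ^ 2 < 1) : ∃ z, lineFun N z = 0 ∧ lineFun N' z = 0 := by
  have htr : (N * N' - N' * N).trace = 0 := by
    rw [Matrix.trace_sub, Matrix.trace_mul_comm, sub_self]
  have hdet : 0 < (N * N' - N' * N).det := by
    rw [h.lineProd_eq h'] at hp
    obtain ⟨h1, h2⟩ := h.entries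
    obtain ⟨h1', h2'⟩ := h'.entries
    rw [Matrix.det_fin_two]
    simp only [Matrix.sub_apply, Matrix.mul_apply, Fin.sum_univ_two, h1, h1']
    generalize N 0 0 = p at *
    generalize N 0 1 = r at *
    generalize N 1 0 = t at *
    generalize N' 0 0 = p' at *
    generalize N' 0 1 = r' at *
    generalize N' 1 0 = t' at *
    have : 0 < 4 * (1 - (p * p' + (r * t' + t * r') / 2) ^ 2) := by linarith
    refine this.trans_eq ?_
    linear_combination -4 * (p' ^ 2 + r' * t') * h2 - 4 * h2'
  obtain ⟨z, c, hz⟩ := exists_pointMatrix_eq_smul _ htr hdet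
  refine ⟨z, ?_, ?_⟩
  · rw [lineFun_pointMatrix hz, Matrix.mul_sub, Matrix.trace_sub, Matrix.trace_mul_comm N (N' * N),
      ← Matrix.mul_assoc, h.2, Matrix.mul_assoc N', h.2]
    simp
  · rw [lineFun_pointMatrix hz, Matrix.mul_sub, Matrix.trace_sub, Matrix.trace_mul_comm N' (N * N'),
      ← Matrix.mul_assoc N', h'.2, Matrix.mul_assoc N, h'.2]
    simp

/-! ### Lifts to `SL(2, ℝ)` -/

lemma exists_lift (f : PSL(2, ℝ)) : ∃ A : SL(2, ℝ), (A : PSL(2, ℝ)) = f :=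
  QuotientGroup.mk_surjective f

lemma coe_eq_one_iff (A : SL(2, ℝ)) :
    (A : PSL(2, ℝ)) = 1 ↔ ∃ r : ℝ, r ^ 2 = 1 ∧ A.1 = r • 1 := by
  rw [QuotientGroup.eq_one_iff, Matrix.SpecialLinearGroup.mem_center_iff]
  constructor
  · rintro ⟨r, hr, h⟩
    refine ⟨r, by simpa using hr, ?_⟩
    rw [← h]
    ext i j
    fin_cases i <;> fin_cases j <;> simp
  · rintro ⟨r, hr, h⟩
    refine ⟨r, by simpa using hr, ?_⟩
    rw [h]
    ext i j
    fin_cases i <;> fin_cases j <;> simp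

lemma coe_neg (A : SL(2, ℝ)) : ((-A : SL(2, ℝ)) : PSL(2, ℝ)) = A := by
  rw [QuotientGroup.eq, ← QuotientGroup.eq_one_iff]
  exact (coe_eq_one_iff _).mpr ⟨-1, by norm_num, by
    rw [Matrix.SpecialLinearGroup.coe_mul]
    have : (-A)⁻¹ = -A⁻¹ := by rw [inv_eq_iff_mul_eq_one]; simp
    rw [this, Matrix.SpecialLinearGroup.coe_neg, Matrix.neg_mul,
      ← Matrix.SpecialLinearGroup.coe_mul]
    simp⟩

lemma dist_psl_smul (f : PSL(2, ℝ)) (z w : ℍ) : dist (f • z) (f • w) = dist z w := by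
  obtain ⟨A, rfl⟩ := exists_lift f
  rw [coe_smul, coe_smul, dist_smul]

lemma sl_det (A : SL(2, ℝ)) : A 0 0 * A 1 1 - A 0 1 * A 1 0 = 1 := by
  rw [← Matrix.det_fin_two]; exact A.2

/-! ### Fixed points and axes -/

lemma smul_infty_eq_iff (A : SL(2, ℝ)) : (A : PSL(2, ℝ)) • (∞ : OnePoint ℝ) = ∞ ↔ A 1 0 = 0 := by
  rw [coe_smul_boundary, OnePoint.smul_infty_eq_self_iff]
  rfl

lemma smul_real_eq_iff (A : SL(2, ℝ)) (x : ℝ) :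
    (A : PSL(2, ℝ)) • (x : OnePoint ℝ) = x ↔
      A 1 0 * x ^ 2 + (A 1 1 - A 0 0) * x - A 0 1 = 0 := by
  have hdet := sl_det A
  rw [coe_smul_boundary, OnePoint.smul_some_eq_ite]
  change (if A 1 0 * x + A 1 1 = 0 then ∞ else
    (((A 0 0 * x + A 0 1) / (A 1 0 * x + A 1 1) : ℝ) : OnePoint ℝ)) = x ↔ _
  split_ifs with h
  · refine iff_of_false (OnePoint.infty_ne_coe x) fun h' => ?_
    have h1 : A 0 0 * x + A 0 1 = 0 := by linear_combination x * h - h'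
    have : (1 : ℝ) = 0 := by
      linear_combination -hdet + A 0 0 * h - A 1 0 * h1
    exact one_ne_zero this
  · rw [OnePoint.coe_eq_coe, div_eq_iff h]
    constructor <;> intro h' <;> linear_combination -h'

lemma lineFun_sl (A : SL(2, ℝ)) (z : ℍ) : lineFun A.1 z =
    (A 1 0 * (z.re ^ 2 + z.im ^ 2) + (A 1 1 - A 0 0) * z.re - A 0 1) / (2 * z.im) := by
  have := z.im_ne_zero
  rw [lineFun, pointMatrix, Matrix.eta_fin_two A.1, Matrix.mul_fin_two]
  simp [Matrix.trace_fin_two]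
  field_simp
  ring

lemma IsHyperbolic.disc_pos_and_axis_eq {A : SL(2, ℝ)} (h : IsHyperbolic (A : PSL(2, ℝ))) :
    4 < A.1.trace ^ 2 ∧ axis (A : PSL(2, ℝ)) = {z | lineFun A.1 z = 0} := by
  have hdet := sl_det A
  have htr : A.1.trace = A 0 0 + A 1 1 := Matrix.trace_fin_two _
  have hlin : ∀ z : ℍ, lineFun A.1 z = 0 ↔
      A 1 0 * (z.re ^ 2 + z.im ^ 2) + (A 1 1 - A 0 0) * z.re - A 0 1 = 0 := by
    intro z
    rw [lineFun_sl, div_eq_zero_iff]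
    have := z.im_ne_zero
    simp [this]
  rw [htr]
  have hfin : ∀ x y : ℝ, x ≠ y → A 1 0 * x ^ 2 + (A 1 1 - A 0 0) * x - A 0 1 = 0 →
      A 1 0 * y ^ 2 + (A 1 1 - A 0 0) * y - A 0 1 = 0 →
      A 1 1 - A 0 0 = -A 1 0 * (x + y) ∧ A 0 1 = -A 1 0 * x * y := by
    intro x y hxy hx hy
    have h1 : A 1 1 - A 0 0 = -A 1 0 * (x + y) := by
      apply mul_left_cancel₀ (sub_ne_zero.mpr hxy)
      linear_combination hx - hy
    exact ⟨h1, by linear_combination -hx + x * h1⟩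
  have hmem : ∀ z : ℍ, z ∈ axis (A : PSL(2, ℝ)) → lineFun A.1 z = 0 := by
    rintro z ⟨p, q, hpq, hp, hq, hz⟩
    rw [hlin]
    rcases hz with ⟨x, y, rfl, rfl, hz⟩ | ⟨x, ⟨rfl, rfl⟩ | ⟨rfl, rfl⟩, hz⟩
    · rw [smul_real_eq_iff] at hp hq
      obtain ⟨h1, h2⟩ := hfin x y (fun h => hpq (by rw [h])) hp hq
      rw [h1, h2]
      linear_combination A 1 0 * hz
    · rw [smul_real_eq_iff] at hp
      rw [smul_infty_eq_iff] at hq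
      rw [hz]
      rw [hq] at hp ⊢
      linear_combination hp
    · rw [smul_real_eq_iff] at hq
      rw [smul_infty_eq_iff] at hp
      rw [hz]
      rw [hp] at hq ⊢
      linear_combination hq
  obtain ⟨p, q, hpq, hset⟩ := Set.ncard_eq_two.mp h
  have hfix : ∀ r : OnePoint ℝ, (A : PSL(2, ℝ)) • r = r ↔ r = p ∨ r = q := fun r => by
    have := Set.ext_iff.mp hset r
    simpa using this
  have hp := (hfix p).mpr (Or.inl rfl)
  have hq := (hfix q).mpr (Or.inr rfl)
  have hinf : ∀ x : ℝ, A 1 0 = 0 → A 1 0 * x ^ 2 + (A 1 1 - A 0 0) * x - A 0 1 = 0 →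
      (∀ y : ℝ, (A : PSL(2, ℝ)) • (y : OnePoint ℝ) = y → y = x) → A 1 1 - A 0 0 ≠ 0 := by
    intro x hc hx huniq hd
    have hb : A 0 1 = 0 := by rw [hc, hd] at hx; linarith
    have := huniq (x + 1) ((smul_real_eq_iff _ _).mpr (by rw [hc, hd, hb]; ring))
    linarith
  suffices 4 < (A 0 0 + A 1 1) ^ 2 ∧ ∀ z : ℍ, lineFun A.1 z = 0 → z ∈ axis (A : PSL(2, ℝ)) from
    ⟨this.1, Set.ext fun z => ⟨hmem z, this.2 z⟩⟩
  have hvert : ∀ x : ℝ, A 1 0 = 0 → A 1 0 * x ^ 2 + (A 1 1 - A 0 0) * x - A 0 1 = 0 →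
      A 1 1 - A 0 0 ≠ 0 → 4 < (A 0 0 + A 1 1) ^ 2 ∧
        ∀ z : ℍ, lineFun A.1 z = 0 → z.re = x := by
    intro x hc hx hne
    refine ⟨?_, fun z hz => ?_⟩
    · have h1 : 0 < (A 1 1 - A 0 0) ^ 2 := by positivity
      rw [hc] at hdet
      linarith
    · rw [hlin, hc] at hz
      rw [hc] at hx
      apply mul_left_cancel₀ hne
      linear_combination hz - hx
  cases p with
  | infty =>
    cases q with
    | infty => exact absurd rfl hpq
    | coe x =>
      rw [smul_infty_eq_iff] at hp
      rw [smul_real_eq_iff] at hq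
      obtain ⟨h1, h2⟩ := hvert x hp hq (hinf x hp hq fun y hy => by simpa using (hfix y).mp hy)
      exact ⟨h1, fun z hz => ⟨∞, x, hpq, (smul_infty_eq_iff A).mpr hp,
        (smul_real_eq_iff A x).mpr hq, Or.inr ⟨x, Or.inr ⟨rfl, rfl⟩, h2 z hz⟩⟩⟩
  | coe x =>
    cases q with
    | infty =>
      rw [smul_infty_eq_iff] at hq
      rw [smul_real_eq_iff] at hp
      obtain ⟨h1, h2⟩ := hvert x hq hp (hinf x hq hp fun y hy => by simpa using (hfix y).mp hy)
      exact ⟨h1, fun z hz => ⟨x, ∞, hpq, (smul_real_eq_iff A x).mpr hp,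
        (smul_infty_eq_iff A).mpr hq, Or.inr ⟨x, Or.inl ⟨rfl, rfl⟩, h2 z hz⟩⟩⟩
    | coe y =>
      rw [smul_real_eq_iff] at hp hq
      have hxy : x ≠ y := fun h => hpq (by rw [h])
      obtain ⟨h1, h2⟩ := hfin x y hxy hp hq
      have hc : A 1 0 ≠ 0 := by
        intro hc
        have := (hfix ∞).mp ((smul_infty_eq_iff A).mpr hc)
        simp at this
      refine ⟨?_, fun z hz => ⟨x, y, hpq, (smul_real_eq_iff A x).mpr hp,
        (smul_real_eq_iff A y).mpr hq, Or.inl ⟨x, y, rfl, rfl, ?_⟩⟩⟩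
      · have h3 : 0 < (A 1 0 * (x - y)) ^ 2 := by
          have := mul_ne_zero hc (sub_ne_zero.mpr hxy)
          positivity
        have h4 : (A 0 0 + A 1 1) ^ 2 - 4 = (A 1 0 * (x - y)) ^ 2 := by
          linear_combination
            4 * A 1 0 * h2 + (A 1 1 - A 0 0 - A 1 0 * (x + y)) * h1 + 4 * hdet
        linarith
      · rw [hlin] at hz
        apply mul_left_cancel₀ hc
        linear_combination hz - z.re * h1 + h2

lemma IsHyperbolic.conj {f : PSL(2, ℝ)} (hf : IsHyperbolic f) (h : PSL(2, ℝ)) :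
    IsHyperbolic (h * f * h⁻¹) := by
  have : {p : OnePoint ℝ | (h * f * h⁻¹) • p = p} =
      (fun p => h • p) '' {p : OnePoint ℝ | f • p = p} := by
    ext p
    simp only [Set.mem_ofPred_eq, Set.mem_image]
    constructor
    · intro hp
      refine ⟨h⁻¹ • p, ?_, smul_inv_smul h p⟩
      rw [mul_smul, mul_smul] at hp
      exact eq_inv_smul_iff.mpr hp
    · rintro ⟨q, hq, rfl⟩
      rw [mul_smul, inv_smul_smul, mul_smul, hq]
  rw [IsHyperbolic, this, Set.ncard_image_of_injective _ (MulAction.injective h)]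
  exact hf

lemma smul_mem_axis_conj {f : PSL(2, ℝ)} (hf : IsHyperbolic f) (h : PSL(2, ℝ)) (z : ℍ) :
    h • z ∈ axis (h * f * h⁻¹) ↔ z ∈ axis f := by
  obtain ⟨A, rfl⟩ := exists_lift f
  obtain ⟨H, rfl⟩ := exists_lift h
  have h1 := hf.disc_pos_and_axis_eq.2
  have h2 : axis ((H : PSL(2, ℝ)) * A * (H : PSL(2, ℝ))⁻¹) = {z | lineFun (H * A * H⁻¹).1 z = 0} :=
    IsHyperbolic.disc_pos_and_axis_eq (A := H * A * H⁻¹) (hf.conj H) |>.2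
  rw [h1, h2, coe_smul]
  simp only [Set.mem_ofPred_eq, Matrix.SpecialLinearGroup.coe_mul, lineFun_conj]

/-! ### Hyperbolic matrices -/

/-- `A` is the hyperbolic matrix with oriented axis `N` and translation length `2 * u`. -/
structure IsTranslation (A : SL(2, ℝ)) (N : Matrix (Fin 2) (Fin 2) ℝ) (u : ℝ) : Prop where
  isLine : IsLine N
  eq : A.1 = Real.cosh u • (1 : Matrix (Fin 2) (Fin 2) ℝ) + Real.sinh u • N

lemma IsHyperbolic.exists_isTranslation {f : PSL(2, ℝ)} (hf : IsHyperbolic f) :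
    ∃ (A : SL(2, ℝ)) (N : Matrix (Fin 2) (Fin 2) ℝ) (u : ℝ), (A : PSL(2, ℝ)) = f ∧ 0 < u ∧
      IsTranslation A N u ∧ axis f = {z | lineFun N z = 0} := by
  obtain ⟨A, hA, htr⟩ : ∃ A : SL(2, ℝ), (A : PSL(2, ℝ)) = f ∧ 0 ≤ A.1.trace := by
    obtain ⟨A, rfl⟩ := exists_lift f
    rcases le_total 0 A.1.trace with h | h
    · exact ⟨A, rfl, h⟩
    · exact ⟨-A, coe_neg A, by
        rw [Matrix.SpecialLinearGroup.coe_neg, Matrix.trace_neg]; linarith⟩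
  subst hA
  obtain ⟨hd, hax⟩ := hf.disc_pos_and_axis_eq
  have hdet := sl_det A
  obtain ⟨T, hT⟩ : ∃ T, T = A.1.trace / 2 := ⟨_, rfl⟩
  have hT2 : 0 < T ^ 2 - 1 := by rw [hT]; linarith
  obtain ⟨s, hs⟩ : ∃ s, s = Real.sqrt (T ^ 2 - 1) := ⟨_, rfl⟩
  have hs0 : 0 < s := hs ▸ Real.sqrt_pos.mpr hT2
  have hs2 : s ^ 2 = T ^ 2 - 1 := by rw [hs, Real.sq_sqrt hT2.le]
  have hcosh : Real.cosh (Real.arsinh s) = T := by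
    rw [Real.cosh_arsinh, hs2, add_sub_cancel, Real.sqrt_sq (by linarith)]
  have hT' : A 0 0 + A 1 1 = 2 * T := by rw [hT, Matrix.trace_fin_two]; ring
  refine ⟨A, s⁻¹ • (A.1 - T • 1), Real.arsinh s, rfl, Real.arsinh_pos_iff.mpr hs0, ⟨⟨?_, ?_⟩, ?_⟩,
    ?_⟩
  · rw [Matrix.trace_smul, Matrix.trace_sub, Matrix.trace_smul, Matrix.trace_one]
    simp [hT]
  · rw [Matrix.smul_mul, Matrix.mul_smul, smul_smul]
    have : (A.1 - T • 1) * (A.1 - T • 1) = (s ^ 2) • (1 : Matrix (Fin 2) (Fin 2) ℝ) := by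
      rw [hs2]
      rw [show T = (A 0 0 + A 1 1) / 2 by linarith]
      ext i j
      fin_cases i <;> fin_cases j <;> simp [Matrix.mul_apply, Fin.sum_univ_two] <;>
        first | ring1 | linear_combination -hdet
    rw [this, smul_smul]
    have : s⁻¹ * s⁻¹ * s ^ 2 = 1 := by field_simp
    rw [this, one_smul]
  · rw [hcosh, Real.sinh_arsinh, smul_smul, mul_inv_cancel₀ hs0.ne', one_smul, add_sub_cancel]
  · rw [hax]
    ext z
    have : lineFun (s⁻¹ • (A.1 - T • 1)) z = s⁻¹ * lineFun A.1 z := by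
      simp only [lineFun, Matrix.smul_mul, Matrix.sub_mul, Matrix.trace_smul, Matrix.trace_sub,
        Matrix.one_mul, trace_pointMatrix]
      simp
      ring
    simp [this, hs0.ne']

lemma IsTranslation.inv {A : SL(2, ℝ)} {N : Matrix (Fin 2) (Fin 2) ℝ} {u : ℝ}
    (h : IsTranslation A N u) : IsTranslation A⁻¹ (-N) u := by
  refine ⟨h.isLine.neg, ?_⟩
  have e : (A⁻¹).1 * A.1 = 1 := by rw [← Matrix.SpecialLinearGroup.coe_mul]; simp
  have e2 : A.1 * (Real.cosh u • (1 : Matrix (Fin 2) (Fin 2) ℝ) + Real.sinh u • -N) = 1 := by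
    rw [h.eq]
    simp only [Matrix.add_mul, Matrix.mul_add, Matrix.smul_mul, Matrix.mul_smul, Matrix.one_mul,
      Matrix.mul_one, Matrix.mul_neg, h.isLine.2, smul_neg]
    have := Real.cosh_sq u
    match_scalars <;> first | ring1 | linear_combination this
  calc (A⁻¹).1 = (A⁻¹).1 * (A.1 * (Real.cosh u • 1 + Real.sinh u • -N)) := by
        rw [e2, Matrix.mul_one]
    _ = _ := by rw [← Matrix.mul_assoc, e, Matrix.one_mul]

lemma IsTranslation.conj {A : SL(2, ℝ)} {N : Matrix (Fin 2) (Fin 2) ℝ} {u : ℝ}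
    (h : IsTranslation A N u) (K : SL(2, ℝ)) :
    IsTranslation (K * A * K⁻¹) (K.1 * N * (K⁻¹).1) u := by
  refine ⟨h.isLine.conj K, ?_⟩
  have e' : K.1 * (K⁻¹).1 = 1 := by rw [← Matrix.SpecialLinearGroup.coe_mul]; simp
  rw [Matrix.SpecialLinearGroup.coe_mul, Matrix.SpecialLinearGroup.coe_mul, h.eq]
  simp only [Matrix.add_mul, Matrix.mul_add, Matrix.smul_mul, Matrix.mul_smul, Matrix.mul_one, e']

lemma IsTranslation.pow {A : SL(2, ℝ)} {N : Matrix (Fin 2) (Fin 2) ℝ} {u : ℝ}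
    (h : IsTranslation A N u) (m : ℕ) : IsTranslation (A ^ m) N (m * u) := by
  refine ⟨h.isLine, ?_⟩
  induction m with
  | zero => simp
  | succ m ih =>
    rw [pow_succ, Matrix.SpecialLinearGroup.coe_mul, ih, h.eq]
    have e : ((m + 1 : ℕ) : ℝ) * u = m * u + u := by push_cast; ring
    rw [e, Real.cosh_add, Real.sinh_add]
    simp only [Matrix.add_mul, Matrix.mul_add, Matrix.smul_mul, Matrix.mul_smul, Matrix.one_mul,
      Matrix.mul_one, h.isLine.2]
    module

lemma mul_add_mul_eq_trace_smul {M N : Matrix (Fin 2) (Fin 2) ℝ} (hM : M.trace = 0)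
    (hN : N.trace = 0) : M * N + N * M = (M * N).trace • (1 : Matrix (Fin 2) (Fin 2) ℝ) := by
  rw [Matrix.trace_fin_two] at hM hN
  have h1 : M 1 1 = -M 0 0 := by linarith
  have h2 : N 1 1 = -N 0 0 := by linarith
  ext i j
  fin_cases i <;> fin_cases j <;>
    simp [Matrix.mul_apply, Matrix.trace_fin_two, Fin.sum_univ_two, h1, h2] <;> ring

lemma mul_pointMatrix_of_lineFun_eq_zero {N : Matrix (Fin 2) (Fin 2) ℝ} (h : N.trace = 0) {z : ℍ}
    (hz : lineFun N z = 0) : pointMatrix z * N = -(N * pointMatrix z) := by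
  have h1 := mul_add_mul_eq_trace_smul h (trace_pointMatrix z)
  have h2 : (N * pointMatrix z).trace = 0 := by rw [lineFun] at hz; linarith
  rw [h2, zero_smul] at h1
  exact eq_neg_of_add_eq_zero_right h1

lemma IsTranslation.pointMatrix_smul {A : SL(2, ℝ)} {N : Matrix (Fin 2) (Fin 2) ℝ} {u : ℝ}
    (h : IsTranslation A N u) {z : ℍ} (hz : lineFun N z = 0) :
    pointMatrix (A • z) = Real.cosh (2 * u) • pointMatrix z +
      Real.sinh (2 * u) • (N * pointMatrix z) := by
  have h1 := mul_pointMatrix_of_lineFun_eq_zero h.isLine.1 hz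
  have h2 : N * (N * pointMatrix z) = pointMatrix z := by
    rw [← Matrix.mul_assoc, h.isLine.2, Matrix.one_mul]
  rw [conj_pointMatrix, h.inv.eq, h.eq]
  simp only [Matrix.add_mul, Matrix.mul_add, Matrix.smul_mul, Matrix.mul_smul, Matrix.one_mul,
    Matrix.mul_one, Matrix.mul_neg, smul_neg, Matrix.mul_assoc, h1, h2, Real.cosh_two_mul,
    Real.sinh_two_mul]
  module

lemma IsTranslation.dist_smul {A : SL(2, ℝ)} {N : Matrix (Fin 2) (Fin 2) ℝ} {u : ℝ}
    (h : IsTranslation A N u) (hu : 0 ≤ u) {z : ℍ} (hz : lineFun N z = 0) :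
    dist z (A • z) = 2 * u := by
  have h1 := mul_pointMatrix_of_lineFun_eq_zero h.isLine.1 hz
  have key : Real.cosh (dist z (A • z)) = Real.cosh (2 * u) := by
    rw [cosh_dist_eq_trace, h.pointMatrix_smul hz, Matrix.mul_add, Matrix.mul_smul, Matrix.mul_smul,
      ← Matrix.mul_assoc, h1, Matrix.neg_mul, Matrix.mul_assoc, pointMatrix_mul_self]
    simp [Matrix.trace_add, h.isLine.1]
  exact Real.cosh_strictMonoOn.injOn dist_nonneg (by simpa using hu) key

lemma IsTranslation.lineFun_smul_self {A : SL(2, ℝ)} {N : Matrix (Fin 2) (Fin 2) ℝ} {u : ℝ}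
    (h : IsTranslation A N u) (z : ℍ) : lineFun N (A • z) = lineFun N z := by
  have e : A.1 * N * (A⁻¹).1 = N := by
    have hc : A.1 * N = N * A.1 := by
      rw [h.eq]; simp only [Matrix.add_mul, Matrix.mul_add, Matrix.smul_mul, Matrix.mul_smul,
        Matrix.one_mul, Matrix.mul_one]
    rw [hc, Matrix.mul_assoc, ← Matrix.SpecialLinearGroup.coe_mul]
    simp
  conv_lhs => rw [← e]
  exact lineFun_conj N A z

lemma IsTranslation.lineFun_smul_add {A : SL(2, ℝ)} {N : Matrix (Fin 2) (Fin 2) ℝ} {u : ℝ}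
    (h : IsTranslation A N u) {z : ℍ} (hz : lineFun N z = 0) (N' : Matrix (Fin 2) (Fin 2) ℝ) :
    lineFun N' (A • z) + lineFun N' (A⁻¹ • z) = 2 * Real.cosh (2 * u) * lineFun N' z := by
  have hz' : lineFun (-N) z = 0 := by rw [lineFun_neg, hz, neg_zero]
  rw [lineFun, lineFun, h.pointMatrix_smul hz, h.inv.pointMatrix_smul hz', lineFun]
  simp only [Matrix.mul_add, Matrix.mul_smul, Matrix.trace_add, Matrix.trace_smul, Matrix.neg_mul,
    Matrix.mul_neg, Matrix.trace_neg, smul_eq_mul]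
  ring

lemma IsTranslation.trace_mul {A B : SL(2, ℝ)} {N N' : Matrix (Fin 2) (Fin 2) ℝ} {u : ℝ}
    (h : IsTranslation A N u) (h' : IsTranslation B N' u) :
    (A * B).1.trace = 2 * (Real.cosh u ^ 2 + Real.sinh u ^ 2 * lineProd N N') := by
  rw [Matrix.SpecialLinearGroup.coe_mul, h.eq, h'.eq, lineProd]
  simp only [Matrix.add_mul, Matrix.mul_add, Matrix.smul_mul, Matrix.mul_smul, Matrix.one_mul,
    Matrix.mul_one, Matrix.trace_add, Matrix.trace_smul, h.isLine.1, h'.isLine.1, smul_eq_mul,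
    Matrix.trace_one]
  simp
  ring

/-! ### Surface groups contain no elliptic elements, and axes are not asymptotic -/

lemma exists_fixed_of_trace {A : SL(2, ℝ)} (h : A.1.trace ^ 2 < 4) : ∃ z : ℍ, A • z = z := by
  have hdet := sl_det A
  obtain ⟨z, c, hz⟩ := exists_pointMatrix_eq_smul (A.1 - (A.1.trace / 2) • 1)
    (by rw [Matrix.trace_sub, Matrix.trace_smul, Matrix.trace_one]; simp) (by
      rw [Matrix.trace_fin_two] at h ⊢
      rw [Matrix.det_fin_two]
      simp
      linarith)
  refine ⟨z, pointMatrix_injective ?_⟩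
  have hcomm : A.1 * pointMatrix z = pointMatrix z * A.1 := by
    rw [hz]
    simp only [Matrix.mul_smul, Matrix.smul_mul, Matrix.mul_sub, Matrix.sub_mul, Matrix.mul_one,
      Matrix.one_mul]
  rw [conj_pointMatrix, hcomm, Matrix.mul_assoc, ← Matrix.SpecialLinearGroup.coe_mul]
  simp

lemma IsSurfaceGroup.four_le_sq_trace {G : Subgroup PSL(2, ℝ)} (hG : IsSurfaceGroup G)
    {A : SL(2, ℝ)} (hA : (A : PSL(2, ℝ)) ∈ G) : 4 ≤ A.1.trace ^ 2 := by
  by_contra! h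
  obtain ⟨z, hz⟩ := exists_fixed_of_trace h
  obtain ⟨r, hr, hA1⟩ := (coe_eq_one_iff A).mp (hG.free _ hA z hz)
  rw [hA1, Matrix.trace_smul, Matrix.trace_one] at h
  simp at h
  linarith

lemma mul_eq_or_eq_neg_of_sq_zero {N M : Matrix (Fin 2) (Fin 2) ℝ} (hN : IsLine N)
    (hM : M.trace = 0) (hMM : M * M = 0) (hNM : M * N = -(N * M)) : N * M = M ∨ N * M = -M := by
  obtain ⟨h1, h2⟩ := hN.entries
  rw [Matrix.trace_fin_two] at hM
  have h3 : M 1 1 = -M 0 0 := by linarith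
  have h4 := congrFun (congrFun hMM 0) 0
  have h5 := congrFun (congrFun hNM 0) 0
  simp only [Matrix.mul_apply, Fin.sum_univ_two, Matrix.neg_apply, Matrix.zero_apply] at h4 h5
  rw [Matrix.eta_fin_two N, Matrix.eta_fin_two M, Matrix.mul_fin_two, h1, h3]
  generalize N 0 0 = p at *
  generalize N 0 1 = r at *
  generalize N 1 0 = t at *
  generalize M 0 0 = u at *
  generalize M 0 1 = v at *
  generalize M 1 0 = w at *
  have key : (p * u + r * w = u ∧ p * v - r * u = v ∧ t * u - p * w = w) ∨
      (p * u + r * w = -u ∧ p * v - r * u = -v ∧ t * u - p * w = -w) := by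
    have e1 : u ^ 2 + v * w = 0 := by linear_combination h4
    have e2 : 2 * p * u + r * w + t * v = 0 := by linear_combination h5
    grind
  refine key.imp ?_ ?_ <;> rintro ⟨k1, k2, k3⟩ <;> ext i j <;> fin_cases i <;> fin_cases j <;>
    simp <;> linarith

lemma IsSurfaceGroup.eq_one_of_contracting {G : Subgroup PSL(2, ℝ)} (hG : IsSurfaceGroup G)
    {X P : SL(2, ℝ)} (hX : (X : PSL(2, ℝ)) ∈ G) (hP : (P : PSL(2, ℝ)) ∈ G)
    {M : Matrix (Fin 2) (Fin 2) ℝ} {t q : ℝ} (hq0 : 0 ≤ q) (hq : q < 1) (hPM : P.1 = 1 + t • M)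
    (hXM : X.1 * M = q • M) (hMX : M * (X⁻¹).1 = q • M) : (P : PSL(2, ℝ)) = 1 := by
  have hpow : ∀ n : ℕ, (X ^ n * P * (X ^ n)⁻¹).1 = 1 + (t * (q ^ 2) ^ n) • M := by
    intro n
    induction n with
    | zero => simp [hPM]
    | succ n ih =>
      have e : X ^ (n + 1) * P * (X ^ (n + 1))⁻¹ = X * (X ^ n * P * (X ^ n)⁻¹) * X⁻¹ := by
        rw [pow_succ']; group
      have e1 : X.1 * (X⁻¹).1 = 1 := by rw [← Matrix.SpecialLinearGroup.coe_mul]; simp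
      rw [e, Matrix.SpecialLinearGroup.coe_mul, Matrix.SpecialLinearGroup.coe_mul, ih]
      simp only [Matrix.add_mul, Matrix.mul_add, Matrix.smul_mul, Matrix.mul_smul, Matrix.mul_one,
        e1, hXM, hMX, smul_smul]
      congr 2
      ring
  have hlim : Filter.Tendsto (fun n : ℕ => X ^ n * P * (X ^ n)⁻¹) Filter.atTop (nhds 1) := by
    refine tendsto_subtype_rng.mpr ?_
    simp only [hpow, Matrix.SpecialLinearGroup.coe_one]
    have h1 : Filter.Tendsto (fun n : ℕ => (q ^ 2) ^ n) Filter.atTop (nhds 0) :=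
      tendsto_pow_atTop_nhds_zero_of_lt_one (by positivity) (by nlinarith)
    have h2 := ((h1.const_mul t).smul_const M).const_add 1
    simpa using h2
  have hlim' := (QuotientGroup.continuous_mk
    (N := Subgroup.center SL(2, ℝ))).continuousAt.tendsto.comp hlim
  have hmem : ∀ n : ℕ, ((X ^ n * P * (X ^ n)⁻¹ : SL(2, ℝ)) : PSL(2, ℝ)) ∈ G := fun n =>
    G.mul_mem (G.mul_mem (G.pow_mem hX n) hP) (G.inv_mem (G.pow_mem hX n))
  have hlimG : Filter.Tendsto (fun n : ℕ => (⟨_, hmem n⟩ : G)) Filter.atTop (nhds 1) := by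
    rw [tendsto_subtype_rng]
    exact hlim'
  have := hG.discrete
  rw [nhds_discrete, Filter.tendsto_pure] at hlimG
  obtain ⟨n, hn⟩ := hlimG.exists
  have hn' : (X : PSL(2, ℝ)) ^ n * P * ((X : PSL(2, ℝ)) ^ n)⁻¹ = 1 := congrArg Subtype.val hn
  simpa [mul_inv_eq_one] using hn'

lemma IsSurfaceGroup.eq_of_lineProd_eq_one {G : Subgroup PSL(2, ℝ)} (hG : IsSurfaceGroup G)
    {A B : SL(2, ℝ)} {N N' : Matrix (Fin 2) (Fin 2) ℝ} {u : ℝ} (hu : 0 < u)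
    (hA : (A : PSL(2, ℝ)) ∈ G) (hB : (B : PSL(2, ℝ)) ∈ G)
    (h : IsTranslation A N u) (h' : IsTranslation B N' u) (hp : lineProd N N' = 1) : N' = N := by
  obtain ⟨M, hM⟩ : ∃ M, M = N' - N := ⟨_, rfl⟩
  have hsum : N * N' + N' * N = (2 : ℝ) • 1 := by
    rw [mul_add_mul_eq_trace_smul h.isLine.1 h'.isLine.1]
    congr 1
    rw [lineProd] at hp
    linarith
  have hN'N : N' * N = (2 : ℝ) • 1 - N * N' := by rw [← hsum]; abel
  have htr : M.trace = 0 := by rw [hM, Matrix.trace_sub, h.isLine.1, h'.isLine.1, sub_zero]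
  have hMM : M * M = 0 := by
    rw [hM]
    simp only [Matrix.sub_mul, Matrix.mul_sub, h.isLine.2, h'.isLine.2, hN'N]
    module
  have hMN : M * N = -(N * M) := by
    rw [hM]
    simp only [Matrix.sub_mul, Matrix.mul_sub, h.isLine.2, hN'N]
    module
  have hN' : N' = N + M := by rw [hM]; abel
  have hcs := Real.cosh_sq u
  have hq := Real.cosh_sub_sinh u
  have hq0 : 0 ≤ Real.cosh u - Real.sinh u := by rw [hq]; positivity
  have hq1 : Real.cosh u - Real.sinh u < 1 := by rw [hq, Real.exp_lt_one_iff]; linarith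
  have hPG : ((B * A⁻¹ : SL(2, ℝ)) : PSL(2, ℝ)) ∈ G := G.mul_mem hB (G.inv_mem hA)
  have hP : (B * A⁻¹).1 = 1 + Real.sinh u • (Real.cosh u • M - Real.sinh u • (M * N)) := by
    rw [Matrix.SpecialLinearGroup.coe_mul, h'.eq, h.inv.eq, hN']
    simp only [Matrix.add_mul, Matrix.mul_add, Matrix.smul_mul, Matrix.mul_smul, Matrix.one_mul,
      Matrix.mul_one, Matrix.mul_neg, smul_neg, h.isLine.2]
    match_scalars <;> first | ring1 | linear_combination hcs
  have hone : ∃ t : ℝ, t ≠ 0 ∧ (B * A⁻¹).1 = 1 + t • M ∧ ((B * A⁻¹ : SL(2, ℝ)) : PSL(2, ℝ)) = 1 := by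
    have hs : 0 < Real.sinh u := Real.sinh_pos_iff.mpr hu
    rcases mul_eq_or_eq_neg_of_sq_zero h.isLine htr hMM hMN with hNM | hNM
    · have hP' : (B * A⁻¹).1 = 1 + (Real.sinh u * (Real.cosh u + Real.sinh u)) • M := by
        rw [hP, hMN, hNM]; module
      refine ⟨_, ?_, hP', hG.eq_one_of_contracting (X := A⁻¹) (G.inv_mem hA) hPG hq0 hq1 hP' ?_ ?_⟩
      · have := Real.cosh_pos u; positivity
      · rw [h.inv.eq]
        simp only [Matrix.add_mul, Matrix.smul_mul, Matrix.one_mul, Matrix.neg_mul, hNM]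
        module
      · rw [inv_inv, h.eq]
        simp only [Matrix.mul_add, Matrix.mul_smul, Matrix.mul_one, hMN, hNM]
        module
    · have hP' : (B * A⁻¹).1 = 1 + (Real.sinh u * (Real.cosh u - Real.sinh u)) • M := by
        rw [hP, hMN, hNM]; module
      refine ⟨_, ?_, hP', hG.eq_one_of_contracting (X := A) hA hPG hq0 hq1 hP' ?_ ?_⟩
      · rw [hq]; positivity
      · rw [h.eq]
        simp only [Matrix.add_mul, Matrix.smul_mul, Matrix.one_mul, hNM]
        module
      · rw [h.inv.eq]
        simp only [Matrix.mul_add, Matrix.mul_smul, Matrix.mul_one, Matrix.mul_neg, hMN, hNM]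
        module
  obtain ⟨t, ht, hP1, hP2⟩ := hone
  obtain ⟨r, -, hr⟩ := (coe_eq_one_iff _).mp hP2
  have hscal : t • M = (r - 1) • (1 : Matrix (Fin 2) (Fin 2) ℝ) := by
    rw [sub_smul, one_smul, ← hr, hP1]; abel
  have hr1 : r - 1 = 0 := by
    have := congrArg Matrix.trace hscal
    rw [Matrix.trace_smul, htr, Matrix.trace_smul, Matrix.trace_one] at this
    simp at this
    exact this
  rw [hr1, zero_smul] at hscal
  have := (smul_eq_zero.mp hscal).resolve_left ht
  rw [hN', this, add_zero]

/-- The collar lemma: distinct disjoint translates of an axis are uniformly far apart. -/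
lemma IsSurfaceGroup.collar {G : Subgroup PSL(2, ℝ)} (hG : IsSurfaceGroup G)
    {A K : SL(2, ℝ)} {N : Matrix (Fin 2) (Fin 2) ℝ} {u : ℝ} (hu : 0 < u)
    (hA : (A : PSL(2, ℝ)) ∈ G) (hK : (K : PSL(2, ℝ)) ∈ G) (h : IsTranslation A N u)
    (hne : ∃ z, lineFun N z = 0)
    (hdisj : ∀ z, lineFun N z = 0 → lineFun (K.1 * N * (K⁻¹).1) z ≠ 0) :
    1 + 2 / Real.sinh u ^ 2 ≤ |lineProd N (K.1 * N * (K⁻¹).1)| := by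
  obtain ⟨z, hz⟩ := hne
  have h' := h.conj K
  have hi := h.inv.conj K
  have hconjG : ((K * A * K⁻¹ : SL(2, ℝ)) : PSL(2, ℝ)) ∈ G :=
    G.mul_mem (G.mul_mem hK hA) (G.inv_mem hK)
  have hconjG' : ((K * A⁻¹ * K⁻¹ : SL(2, ℝ)) : PSL(2, ℝ)) ∈ G :=
    G.mul_mem (G.mul_mem hK (G.inv_mem hA)) (G.inv_mem hK)
  have t1 := hG.four_le_sq_trace (A := A * (K * A * K⁻¹)) (G.mul_mem hA hconjG)
  have t2 := hG.four_le_sq_trace (A := A * (K * A⁻¹ * K⁻¹)) (G.mul_mem hA hconjG')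
  rw [h.trace_mul h'] at t1
  rw [h.trace_mul hi] at t2
  have hneg : K.1 * -N * (K⁻¹).1 = -(K.1 * N * (K⁻¹).1) := by simp
  rw [hneg] at t2 hi
  have hdisjz := hdisj z hz
  have hge : 1 ≤ lineProd N (K.1 * N * (K⁻¹).1) ^ 2 := by
    by_contra! hlt
    obtain ⟨w, hw, hw'⟩ := exists_meet h.isLine h'.isLine hlt
    exact hdisj w hw hw'
  have hpn : lineProd N (-(K.1 * N * (K⁻¹).1)) = -lineProd N (K.1 * N * (K⁻¹).1) := by
    simp [lineProd]; ring
  have hne1 : lineProd N (K.1 * N * (K⁻¹).1) ≠ 1 := fun hp => hdisjz <| by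
    rw [hG.eq_of_lineProd_eq_one hu hA hconjG h h' hp, hz]
  have hne2 : lineProd N (K.1 * N * (K⁻¹).1) ≠ -1 := fun hp => hdisjz <| by
    have := hG.eq_of_lineProd_eq_one hu hA hconjG' h hi (by rw [hpn, hp, neg_neg])
    rw [← neg_neg (K.1 * N * (K⁻¹).1), this, lineFun_neg, hz, neg_zero]
  rw [hpn] at t2
  have hc := Real.cosh_sq u
  have hs : 0 < Real.sinh u ^ 2 := by
    have := Real.sinh_pos_iff.mpr hu
    positivity
  generalize lineProd N (K.1 * N * (K⁻¹).1) = ν at *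
  rw [hc] at t1 t2
  generalize Real.sinh u ^ 2 = S at *
  have key : ∀ μ : ℝ, 1 < μ → 4 ≤ (2 * (S + 1 + S * -μ)) ^ 2 → 1 + 2 / S ≤ μ := by
    intro μ hμ h4
    have h1 : S + 1 + S * -μ < 1 := by nlinarith
    have h2 : S + 1 + S * -μ ≤ -1 := by nlinarith
    have h3 : 2 / S ≤ μ - 1 := by rw [div_le_iff₀ hs]; nlinarith
    linarith
  rcases le_total 0 ν with h0 | h0
  · rw [abs_of_nonneg h0]
    exact key ν (lt_of_le_of_ne (by nlinarith) hne1.symm) t2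
  · rw [abs_of_nonpos h0]
    refine key (-ν) (lt_of_le_of_ne (by nlinarith) fun h => hne2 (by linarith)) ?_
    rw [neg_neg]; exact t1

/-! ### Translates of lines -/

lemma IsLine.exists_translate {N : Matrix (Fin 2) (Fin 2) ℝ} (h : IsLine N) (k : PSL(2, ℝ)) :
    ∃ N', IsLine N' ∧ ∀ z, lineFun N' z = lineFun N (k • z) := by
  obtain ⟨K, hK⟩ := exists_lift k⁻¹
  refine ⟨_, h.conj K, fun z => ?_⟩
  rw [lineFun_conj_inv, ← coe_smul, ← inv_inv k, ← hK]
  rfl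

lemma IsLine.exists_crossing {N : Matrix (Fin 2) (Fin 2) ℝ} (h : IsLine N) (k : PSL(2, ℝ)) {x y : ℍ}
    (hx : lineFun N (k • x) ≤ 0) (hy : 0 ≤ lineFun N (k • y)) :
    ∃ v, lineFun N (k • v) = 0 ∧ dist x v + dist v y = dist x y ∧
      ∃ a b : ℝ, 0 ≤ a ∧ 0 ≤ b ∧ ∀ N' : Matrix (Fin 2) (Fin 2) ℝ, IsLine N' → ∀ k' : PSL(2, ℝ),
        lineFun N' (k' • v) = a * lineFun N' (k' • x) + b * lineFun N' (k' • y) := by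
  obtain ⟨M, hM, hMk⟩ := h.exists_translate k
  rw [← hMk] at hx hy
  obtain ⟨v, hv, hd, a, b, ha, hb, hab⟩ := NonCancellation.exists_crossing hM.1 hx hy
  refine ⟨v, by rw [← hMk, hv], hd, a, b, ha, hb, fun N' hN' k' => ?_⟩
  obtain ⟨M', hM', hMk'⟩ := hN'.exists_translate k'
  rw [← hMk', ← hMk', ← hMk', hab M' hM'.1]

/-! ### Hyperbolic elements and simple axes -/

lemma IsHyperbolic.smul_mem_axis {f : PSL(2, ℝ)} (hf : IsHyperbolic f) {z : ℍ} (hz : z ∈ axis f) :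
    f • z ∈ axis f := by
  obtain ⟨A, N, u, rfl, -, hA, hax⟩ := hf.exists_isTranslation
  rw [hax] at hz ⊢
  exact (hA.lineFun_smul_self z).trans hz

lemma IsHyperbolic.translationNumber_eq {f : PSL(2, ℝ)} (hf : IsHyperbolic f) {z : ℍ}
    (hz : z ∈ axis f) : translationNumber f = dist z (f • z) ∧ 0 < dist z (f • z) := by
  obtain ⟨A, N, u, rfl, hu, hA, hax⟩ := hf.exists_isTranslation
  have hd : ∀ w ∈ axis (A : PSL(2, ℝ)), dist w ((A : PSL(2, ℝ)) • w) = 2 * u := fun w hw => by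
    rw [hax] at hw
    exact hA.dist_smul hu.le hw
  have : Nonempty (axis (A : PSL(2, ℝ))) := ⟨⟨z, hz⟩⟩
  rw [hd z hz, translationNumber]
  refine ⟨?_, by positivity⟩
  simp only [fun w : axis (A : PSL(2, ℝ)) => hd w w.2, ciInf_const]

lemma IsHyperbolic.lineFun_inv_smul {f : PSL(2, ℝ)} (hf : IsHyperbolic f) {z : ℍ} (hz : z ∈ axis f)
    {N : Matrix (Fin 2) (Fin 2) ℝ} (hN : lineFun N z = 0) :
    lineFun N (f⁻¹ • z) = -lineFun N (f • z) := by
  obtain ⟨A, M, u, rfl, -, hA, hax⟩ := hf.exists_isTranslation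
  rw [hax] at hz
  have := hA.lineFun_smul_add hz N
  rw [hN, mul_zero] at this
  exact eq_neg_of_add_eq_zero_right this

/-- The axis of the simple closed geodesic `α`, with a choice of its sides; `2 * u` is the
translation number of `α`. -/
structure IsSimpleAxis (G : Subgroup PSL(2, ℝ)) (α : PSL(2, ℝ)) (N : Matrix (Fin 2) (Fin 2) ℝ)
    (u : ℝ) : Prop where
  pos : 0 < u
  mem : α ∈ G
  isLine : IsLine N
  axis_eq : axis α = {z | lineFun N z = 0}
  stab : ∀ k ∈ G, ∀ z, lineFun N z = 0 → lineFun N (k • z) = 0 → ∃ n : ℤ, k = α ^ n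
  lineFun_smul : ∀ z, lineFun N (α • z) = lineFun N z
  dist_pow_smul : ∀ (m : ℕ) z, lineFun N z = 0 → dist z (α ^ m • z) = m * (2 * u)
  collar : ∀ k ∈ G, (∃ z, lineFun N z = 0) → (∀ z, lineFun N z = 0 → lineFun N (k⁻¹ • z) ≠ 0) →
    ∃ N', IsLine N' ∧ (∀ z, lineFun N' z = lineFun N (k⁻¹ • z)) ∧
      1 + 2 / Real.sinh u ^ 2 ≤ |lineProd N N'|

lemma IsSimpleClosedGeodesic.exists_isSimpleAxis {G : Subgroup PSL(2, ℝ)} (hG : IsSurfaceGroup G)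
    {α : PSL(2, ℝ)} (h : IsSimpleClosedGeodesic G α) : ∃ N u, IsSimpleAxis G α N u := by
  obtain ⟨hmem, hhyp, hs⟩ := h
  obtain ⟨A, N, u, rfl, hu, hA, hax⟩ := hhyp.exists_isTranslation
  refine ⟨N, u, hu, hmem, hA.isLine, hax, ?_, hA.lineFun_smul_self, ?_, ?_⟩
  · intro k hk z hz hkz
    rw [hax] at hs
    obtain ⟨n, hn⟩ := hs k hk z hz hkz
    refine ⟨n, ?_⟩
    rw [← inv_mul_eq_one]
    exact hG.free _ (G.mul_mem (G.inv_mem hk) (G.zpow_mem hmem n)) z (by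
      rw [mul_smul, ← hn, inv_smul_smul])
  · intro m z hz
    have := (hA.pow m).dist_smul (by positivity) hz
    rw [show (m : ℝ) * (2 * u) = 2 * (m * u) by ring, ← this]
    rfl
  · intro k hk hne hdisj
    obtain ⟨K, rfl⟩ := exists_lift k
    have hz : ∀ z, lineFun (K.1 * N * (K⁻¹).1) z = lineFun N ((K : PSL(2, ℝ))⁻¹ • z) :=
      lineFun_conj_inv N K
    exact ⟨_, hA.isLine.conj K, hz, hG.collar hu hmem hk hA hne fun z h0 => by
      rw [hz]; exact hdisj z h0⟩

namespace IsSimpleAxis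

variable {G : Subgroup PSL(2, ℝ)} {α : PSL(2, ℝ)} {N : Matrix (Fin 2) (Fin 2) ℝ} {u : ℝ}

lemma neg (S : IsSimpleAxis G α N u) : IsSimpleAxis G α (-N) u where
  pos := S.pos
  mem := S.mem
  isLine := S.isLine.neg
  axis_eq := by simp only [lineFun_neg, neg_eq_zero, S.axis_eq]
  stab := by simpa only [lineFun_neg, neg_eq_zero] using S.stab
  lineFun_smul := by simpa only [lineFun_neg, neg_inj] using S.lineFun_smul
  dist_pow_smul := by simpa only [lineFun_neg, neg_eq_zero] using S.dist_pow_smul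
  collar := by
    intro k hk hne hdisj
    simp only [lineFun_neg, neg_eq_zero, ne_eq] at hne hdisj
    obtain ⟨N', h1, h2, h3⟩ := S.collar k hk hne hdisj
    refine ⟨-N', h1.neg, fun z => by rw [lineFun_neg, lineFun_neg, h2], ?_⟩
    rwa [lineProd, neg_mul_neg]

lemma lineFun_zpow_smul (S : IsSimpleAxis G α N u) (n : ℤ) (z : ℍ) :
    lineFun N (α ^ n • z) = lineFun N z := by
  induction n with
  | zero => simp
  | succ n ih => rw [zpow_add_one, ← (Commute.self_zpow α n).eq, mul_smul, S.lineFun_smul, ih]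
  | pred n ih =>
    rw [← S.lineFun_smul, ← mul_smul, ← zpow_one_add, add_sub_cancel]
    exact ih

lemma lineFun_pow_smul (S : IsSimpleAxis G α N u) (n : ℕ) (z : ℍ) :
    lineFun N (α ^ n • z) = lineFun N z := by
  simpa using S.lineFun_zpow_smul n z

lemma pos_of_pos (S : IsSimpleAxis G α N u) {k : PSL(2, ℝ)} (hk : k ∈ G) {P z : ℍ}
    (hP : lineFun N P = 0) (hkP : 0 < lineFun N (k • P)) (hz : lineFun N z = 0) :
    0 < lineFun N (k • z) := by
  by_contra! h
  obtain ⟨v, hv, -, a, b, -, -, hab⟩ := S.isLine.exists_crossing k h hkP.le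
  have hv0 := hab N S.isLine 1
  simp only [one_smul, hz, hP, mul_zero, add_zero] at hv0
  obtain ⟨n, rfl⟩ := S.stab k hk v hv0 hv
  rw [S.lineFun_zpow_smul, hP] at hkP
  exact lt_irrefl _ hkP

/-- The half-planes bounded by the translates of the axis of `α` under `α ^ m * β` are nested. -/
lemma nested (S : IsSimpleAxis G α N u) {β : PSL(2, ℝ)} (hβ : β ∈ G) (hh : IsHyperbolic β) {P : ℍ}
    (hP : lineFun N P = 0) (hPβ : P ∈ axis β) (hpos : 0 < lineFun N (β • P)) (m : ℕ) (z : ℍ)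
    (hz : 0 ≤ lineFun N z) : 0 < lineFun N ((α ^ m * β) • z) := by
  by_contra! h
  have hgP : 0 ≤ lineFun N ((α ^ m * β) • P) := by
    rw [mul_smul, S.lineFun_pow_smul]; exact hpos.le
  obtain ⟨v, hv, -, a, b, ha, hb, hab⟩ := S.isLine.exists_crossing _ h hgP
  have hv0 := hab N S.isLine 1
  simp only [one_smul, hP, mul_zero, add_zero] at hv0
  have hv1 : 0 ≤ lineFun N v := hv0 ▸ mul_nonneg ha hz
  rw [mul_smul, S.lineFun_pow_smul] at hv
  have hP' : lineFun (-N) P = 0 := by rw [lineFun_neg, hP, neg_zero]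
  have := S.neg.pos_of_pos (G.inv_mem hβ) (z := β • v) hP'
    (by rw [lineFun_neg, hh.lineFun_inv_smul hPβ hP, neg_neg]; exact hpos)
    (by rw [lineFun_neg, hv, neg_zero])
  rw [inv_smul_smul, lineFun_neg] at this
  linarith

lemma le_cosh_dist (S : IsSimpleAxis G α N u) {k : PSL(2, ℝ)} (hk : k ∈ G)
    (hdisj : ∀ z, lineFun N z = 0 → lineFun N (k⁻¹ • z) ≠ 0) {x x' : ℍ} (hx : lineFun N x = 0)
    (hx' : lineFun N (k⁻¹ • x') = 0) : 1 + 2 / Real.sinh u ^ 2 ≤ Real.cosh (dist x x') := by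
  obtain ⟨N', h1, h2, h3⟩ := S.collar k hk ⟨x, hx⟩ hdisj
  rw [← h2] at hx'
  have := sq_lineProd_le S.isLine h1 hx hx'
  exact h3.trans (abs_le_of_sq_le_sq this (Real.cosh_pos _).le)

lemma cosh_sq_le (S : IsSimpleAxis G α N u) {k : PSL(2, ℝ)} (hk : k ∈ G)
    (hdisj : ∀ z, lineFun N z = 0 → lineFun N (k⁻¹ • z) ≠ 0) {x x' y y' : ℍ} {K : ℝ}
    (hx : lineFun N x = 0) (hx' : lineFun N (k⁻¹ • x') = 0) (hy : lineFun N y = 0)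
    (hy' : lineFun N (k⁻¹ • y') = 0) (hxx : dist x' x ≤ K) (hyy : dist y' y ≤ K) :
    2 / Real.sinh u ^ 2 * Real.cosh (dist x' y' / 2) ^ 2 ≤ Real.sinh K ^ 2 := by
  obtain ⟨N', h1, h2, h3⟩ := S.collar k hk ⟨x, hx⟩ hdisj
  rw [← h2] at hx' hy'
  refine le_trans ?_ (lineProd_fellow_travel h1 S.isLine hx' hy' hx hy hxx hyy)
  have hsymm : lineProd N' N = lineProd N N' := by rw [lineProd, lineProd, Matrix.trace_mul_comm]
  have hs : 0 ≤ 2 / Real.sinh u ^ 2 := by positivity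
  rw [hsymm, ← sq_abs (lineProd N N')]
  gcongr
  nlinarith

end IsSimpleAxis

/-! ### Nested half-planes -/

lemma mul_le_dist_pow_smul {N : Matrix (Fin 2) (Fin 2) ℝ} (hN : IsLine N) {g : PSL(2, ℝ)} {δ : ℝ}
    (hn : ∀ z, 0 ≤ lineFun N z → 0 < lineFun N (g • z))
    (hδ : ∀ w v, lineFun N w = 0 → lineFun N (g⁻¹ • v) = 0 → δ ≤ dist w v) (K : ℕ) :
    ∀ p z, lineFun N p ≤ 0 → 0 ≤ lineFun N z → K * δ ≤ dist p (g ^ K • z) := by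
  have hpos : ∀ v, lineFun N (g⁻¹ • v) = 0 → 0 < lineFun N v := fun v hv => by
    simpa using hn (g⁻¹ • v) hv.ge
  induction K with
  | zero => intro p z _ _; simp
  | succ K ih =>
    intro p z hp hz
    have h1 : lineFun N (g⁻¹ • p) ≤ 0 := by
      by_contra! h
      have := hn _ h.le
      rw [smul_inv_smul] at this
      linarith
    have hgz : ∀ K : ℕ, 0 ≤ lineFun N (g ^ K • z) := by
      intro K
      induction K with
      | zero => simpa
      | succ K ih => rw [pow_succ', mul_smul]; exact (hn _ ih).le
    have h2 : 0 ≤ lineFun N (g⁻¹ • (g ^ (K + 1) • z)) := by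
      rw [pow_succ', mul_smul, inv_smul_smul]; exact hgz K
    obtain ⟨v, hv, hd, -⟩ := hN.exists_crossing g⁻¹ h1 h2
    obtain ⟨w, hw, hd', -⟩ := hN.exists_crossing 1 (x := p) (y := v) (by simpa using hp)
      (by simpa using (hpos v hv).le)
    rw [one_smul] at hw
    have h3 := hδ w v hw hv
    have h4 := ih (g⁻¹ • v) z hv.le hz
    have h5 : dist (g⁻¹ • v) (g ^ K • z) = dist v (g ^ (K + 1) • z) := by
      rw [← dist_psl_smul g, smul_inv_smul, ← mul_smul, ← pow_succ']
    have h6 : 0 ≤ dist p w := dist_nonneg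
    push_cast
    linarith

/-- If a line lies strictly between two consecutive lines of the nested sequence, then the sides of
the lines are nested accordingly. -/
lemma nested_between {N N₁ : Matrix (Fin 2) (Fin 2) ℝ} (hN : IsLine N) (hN₁ : IsLine N₁)
    {g : PSL(2, ℝ)}
    (hn₁ : ∀ z, 0 ≤ lineFun N₁ z → 0 < lineFun N₁ (g • z)) {P₁ : ℍ} (hP₁ : lineFun N₁ P₁ = 0)
    (hdis : ∀ z, lineFun N₁ z = 0 → lineFun N z ≠ 0 ∧ lineFun N (g⁻¹ • z) ≠ 0)
    (h0 : 0 < lineFun N P₁) (h1 : lineFun N (g⁻¹ • P₁) < 0) :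
    (∀ z, lineFun N₁ z = 0 → 0 < lineFun N z ∧ lineFun N (g⁻¹ • z) < 0) ∧
      (∀ z, 0 ≤ lineFun N₁ z → 0 < lineFun N z) ∧
      (∀ z, 0 ≤ lineFun N (g⁻¹ • z) → 0 < lineFun N₁ z) := by
  have hd : ∀ z, lineFun N₁ z = 0 → 0 < lineFun N z ∧ lineFun N (g⁻¹ • z) < 0 := by
    intro z hz
    constructor
    · by_contra! h
      obtain ⟨v, hv, -, a, b, -, -, hab⟩ := hN.exists_crossing 1 (x := z) (y := P₁)
        (by simpa using h) (by simpa using h0.le)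
      have hv1 := hab N₁ hN₁ 1
      simp only [one_smul, hz, hP₁, mul_zero, add_zero] at hv1 hv
      exact (hdis v hv1).1 hv
    · by_contra! h
      obtain ⟨v, hv, -, a, b, -, -, hab⟩ := hN.exists_crossing g⁻¹ (x := P₁) (y := z) h1.le h
      have hv1 := hab N₁ hN₁ 1
      simp only [one_smul, hz, hP₁, mul_zero, add_zero] at hv1
      exact (hdis v hv1).2 hv
  refine ⟨hd, fun z hz => ?_, fun z hz => ?_⟩
  · by_contra! h
    have hy : lineFun N₁ (g⁻¹ • P₁) ≤ 0 := by
      by_contra! h'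
      have := hn₁ _ h'.le
      rw [smul_inv_smul, hP₁] at this
      exact lt_irrefl _ this
    obtain ⟨v, hv, -, a, b, ha, hb, hab⟩ := hN₁.exists_crossing 1 (x := g⁻¹ • P₁) (y := z)
      (by simpa using hy) (by simpa using hz)
    have hv1 := hab N hN 1
    simp only [one_smul] at hv1 hv
    have := (hd v hv).1
    have e1 := mul_nonpos_of_nonneg_of_nonpos ha h1.le
    have e2 := mul_nonpos_of_nonneg_of_nonpos hb h
    linarith
  · by_contra! h
    obtain ⟨v, hv, -, a, b, ha, hb, hab⟩ := hN₁.exists_crossing 1 (x := z) (y := g • P₁)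
      (by simpa using h) (by simpa using (hn₁ P₁ hP₁.ge).le)
    have hv1 := hab N hN g⁻¹
    rw [inv_smul_smul] at hv1
    rw [one_smul] at hv
    have := (hd v hv).2
    have e1 := mul_nonneg ha hz
    have e2 := mul_nonneg hb h0.le
    linarith

lemma IsSimpleAxis.strip_bound {G : Subgroup PSL(2, ℝ)} {α : PSL(2, ℝ)}
    {N N₁ : Matrix (Fin 2) (Fin 2) ℝ} {u L : ℝ} (S : IsSimpleAxis G α N u) (hN₁ : IsLine N₁)
    {g k : PSL(2, ℝ)} (hg : g ∈ G) (hk : k ∈ G)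
    (hn₁ : ∀ z, 0 ≤ lineFun N₁ z → 0 < lineFun N₁ (g • z))
    (hkN : ∀ z, lineFun N₁ z = 0 ↔ lineFun N (k⁻¹ • z) = 0)
    (hdis : ∀ z, lineFun N₁ z = 0 → lineFun N z ≠ 0 ∧ lineFun N (g⁻¹ • z) ≠ 0)
    {P v P₁ w : ℍ} (hP : lineFun N P = 0) (hv : lineFun N v = 0) (hP₁ : lineFun N₁ P₁ = 0)
    (hw : lineFun N₁ w = 0) (hvP : dist v (g • P) ≤ L) (hwP : dist w (g • P₁) ≤ L)
    (h0 : 0 < lineFun N P₁) (h1 : lineFun N (g⁻¹ • P₁) < 0) :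
    2 / Real.sinh u ^ 2 * Real.cosh (dist P₁ w / 4) ^ 2 ≤ Real.sinh L ^ 2 := by
  obtain ⟨hd, he, hf⟩ := nested_between S.isLine hN₁ hn₁ hP₁ hdis h0 h1
  have hdisk : ∀ z, lineFun N z = 0 → lineFun N (k⁻¹ • z) ≠ 0 := fun z hz hkz =>
    (hdis z ((hkN z).mpr hkz)).1 hz
  have hdisk' : ∀ z, lineFun N z = 0 → lineFun N ((g⁻¹ * k)⁻¹ • z) ≠ 0 := fun z hz hkz => by
    rw [mul_inv_rev, inv_inv, mul_smul] at hkz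
    refine (hdis (g • z) ((hkN _).mpr hkz)).2 ?_
    rwa [inv_smul_smul]
  have hvneg : lineFun N₁ v ≤ 0 := by
    by_contra! h
    have := he v h.le
    linarith
  obtain ⟨Q, hQ, hQd, -⟩ := hN₁.exists_crossing 1 (x := v) (y := g • P) (by simpa using hvneg)
    (by rw [one_smul]; exact (hf _ (by rw [inv_smul_smul, hP])).le)
  obtain ⟨R, hR, hRd, -⟩ := S.isLine.exists_crossing g⁻¹ (x := w) (y := g • P₁) (hd w hw).2.le
    (by rw [inv_smul_smul]; exact h0.le)
  rw [one_smul] at hQ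
  have d1 := dist_nonneg (x := v) (y := Q)
  have d2 := dist_nonneg (x := Q) (y := g • P)
  have d3 := dist_nonneg (x := w) (y := R)
  have d4 := dist_nonneg (x := R) (y := g • P₁)
  have key : ∀ d, dist P₁ w / 2 ≤ d → Real.cosh (dist P₁ w / 4) ≤ Real.cosh (d / 2) := by
    intro d hd
    have := dist_nonneg (x := P₁) (y := w)
    rw [Real.cosh_le_cosh, abs_of_nonneg (by linarith), abs_of_nonneg (by linarith)]
    linarith
  have hcase : dist P₁ w / 2 ≤ dist P₁ Q ∨ dist P₁ w / 2 ≤ dist Q w := by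
    by_contra! h
    have := dist_triangle P₁ Q w
    linarith
  have hs : 0 ≤ 2 / Real.sinh u ^ 2 := by positivity
  rcases hcase with h | h
  · have := S.cosh_sq_le (x := g⁻¹ • R) (x' := P₁) (y := v) (y' := Q) (K := L) hk hdisk hR
      ((hkN _).mp hP₁) hv ((hkN _).mp hQ)
      (by rw [← dist_psl_smul g, smul_inv_smul, dist_comm]; linarith)
      (by rw [dist_comm]; linarith)
    refine le_trans ?_ this
    gcongr
    exact key _ h
  · have hmem : ∀ z, lineFun N₁ z = 0 → lineFun N ((g⁻¹ * k)⁻¹ • (g⁻¹ • z)) = 0 := fun z hz => by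
      rw [mul_inv_rev, inv_inv, mul_smul, smul_inv_smul]
      exact (hkN z).mp hz
    have := S.cosh_sq_le (x := P) (x' := g⁻¹ • Q) (y := g⁻¹ • R) (y' := g⁻¹ • w) (K := L)
      (G.mul_mem (G.inv_mem hg) hk) hdisk' hP (hmem Q hQ) hR (hmem w hw)
      (by rw [← dist_psl_smul g, smul_inv_smul]; linarith)
      (by rw [dist_psl_smul]; linarith)
    rw [dist_psl_smul] at this
    refine le_trans ?_ this
    gcongr
    exact key _ h

/-! ### Equivariance of the piecewise geodesics -/

lemma geodesicArc_smul (f : PSL(2, ℝ)) (x y : ℍ) {s : ℝ} (hs : s ∈ Set.Icc (0 : ℝ) 1) :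
    geodesicArc (f • x) (f • y) s = f • geodesicArc x y s := by
  have h := geodesicArc_spec x y s hs
  refine (existsUnique_geodesicPoint (f • x) (f • y) s hs).unique (geodesicArc_spec _ _ s hs) ?_
  rwa [dist_psl_smul, dist_psl_smul, dist_psl_smul]

lemma onePeriod_conj (c a b : PSL(2, ℝ)) (P : ℍ) {s : ℝ} (hs : s ∈ Set.Icc (0 : ℝ) 1) :
    onePeriod (c * a * c⁻¹) (c * b * c⁻¹) (c • P) s = c • onePeriod a b P s := by
  have e1 : (c * a * c⁻¹) • c • P = c • a • P := by simp only [mul_smul, inv_smul_smul]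
  have e2 : (c * a * c⁻¹ * (c * b * c⁻¹)) • c • P = c • (a * b) • P := by
    simp only [mul_smul, inv_smul_smul]
  rw [onePeriod, onePeriod, e1, e2]
  split_ifs with h
  · exact geodesicArc_smul c _ _ ⟨by linarith [hs.1], by linarith⟩
  · exact geodesicArc_smul c _ _ ⟨by linarith, by linarith [hs.2]⟩

lemma piecewiseGeodesic_conj (c a b : PSL(2, ℝ)) (P : ℍ) (t : ℝ) :
    piecewiseGeodesic (c * a * c⁻¹) (c * b * c⁻¹) (c • P) t = c • piecewiseGeodesic a b P t := by
  have e : c * a * c⁻¹ * (c * b * c⁻¹) = c * (a * b) * c⁻¹ := by group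
  rw [piecewiseGeodesic, piecewiseGeodesic, e, conj_zpow,
    onePeriod_conj c a b P ⟨Int.fract_nonneg t, (Int.fract_lt_one t).le⟩]
  simp only [mul_smul, inv_smul_smul]

lemma piecewiseGeodesic_add_int (a b : PSL(2, ℝ)) (P : ℍ) (t : ℝ) (n : ℤ) :
    piecewiseGeodesic a b P (t + n) = (a * b) ^ n • piecewiseGeodesic a b P t := by
  rw [piecewiseGeodesic, piecewiseGeodesic, Int.floor_add_intCast, Int.fract_add_intCast, add_comm,
    zpow_add, mul_smul]

lemma IsSimpleClosedGeodesic.conj {G : Subgroup PSL(2, ℝ)} {α h : PSL(2, ℝ)}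
    (hα : IsSimpleClosedGeodesic G α) (hh : h ∈ G) : IsSimpleClosedGeodesic G (h * α * h⁻¹) := by
  obtain ⟨hm, hhyp, hs⟩ := hα
  refine ⟨G.mul_mem (G.mul_mem hh hm) (G.inv_mem hh), hhyp.conj h, fun g hg z hz hgz => ?_⟩
  have e1 : z = h • h⁻¹ • z := (smul_inv_smul h z).symm
  have e2 : g • z = h • (h⁻¹ * g * h) • h⁻¹ • z := by simp only [mul_smul, smul_inv_smul]
  rw [e1, smul_mem_axis_conj hhyp] at hz
  rw [e2, smul_mem_axis_conj hhyp] at hgz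
  obtain ⟨n, hn⟩ := hs _ (G.mul_mem (G.mul_mem (G.inv_mem hh) hg) hh) _ hz hgz
  exact ⟨n, by rw [e2, hn, conj_zpow]; simp only [mul_smul]⟩

lemma conj_conclusion {α α₁ β β₁ c : PSL(2, ℝ)} {P P₁ : ℍ} (hα : IsHyperbolic α)
    (hβ : IsHyperbolic β) (hP : axis α ∩ axis β = {P}) (hP₁ : axis α₁ ∩ axis β₁ = {P₁}) {m : ℕ}
    (heq : α ^ m * β = α₁ ^ m * β₁) (n : ℤ) (hc : c = (α ^ m * β) ^ n) (hα₁ : α₁ = c * α * c⁻¹) :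
    (∀ t : ℝ, piecewiseGeodesic (α₁ ^ m) β₁ P₁ t = piecewiseGeodesic (α ^ m) β P (t + n)) ∧
      β₁ = c * β * c⁻¹ := by
  have hcomm : c * (α ^ m * β) * c⁻¹ = α ^ m * β := by
    rw [hc, (Commute.zpow_self (α ^ m * β) n).eq, mul_inv_cancel_right]
  have hpow : α₁ ^ m = c * α ^ m * c⁻¹ := by rw [hα₁, conj_pow]
  have hβ₁ : β₁ = c * β * c⁻¹ := by
    calc β₁ = (α₁ ^ m)⁻¹ * (c * (α ^ m * β) * c⁻¹) := by rw [hcomm, heq, inv_mul_cancel_left]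
      _ = c * β * c⁻¹ := by rw [hpow]; group
  have hPP : P₁ = c • P := by
    have h1 : P ∈ axis α ∩ axis β := by rw [hP]; rfl
    have h2 : c • P ∈ axis α₁ ∩ axis β₁ := by
      rw [hα₁, hβ₁]
      exact ⟨(smul_mem_axis_conj hα c P).mpr h1.1, (smul_mem_axis_conj hβ c P).mpr h1.2⟩
    rw [hP₁] at h2
    exact h2.symm
  refine ⟨fun t => ?_, hβ₁⟩
  rw [hpow, hβ₁, hPP, piecewiseGeodesic_conj, piecewiseGeodesic_add_int, ← hc]

/-! ### The position of `P₁` among the translates of the axis of `α` -/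

lemma exists_strip {N : Matrix (Fin 2) (Fin 2) ℝ} (hN : IsLine N) {g : PSL(2, ℝ)} {δ : ℝ}
    (hδ0 : 0 < δ) (hn : ∀ z, 0 ≤ lineFun N z → 0 < lineFun N (g • z))
    (hδ : ∀ w v, lineFun N w = 0 → lineFun N (g⁻¹ • v) = 0 → δ ≤ dist w v) {P : ℍ}
    (hP : lineFun N P = 0) (z : ℍ) :
    ∃ j : ℤ, 0 ≤ lineFun N (g ^ (-j) • z) ∧ lineFun N (g⁻¹ • g ^ (-j) • z) < 0 := by
  obtain ⟨K, hK⟩ := exists_nat_gt (dist P z / δ)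
  rw [div_lt_iff₀ hδ0] at hK
  obtain ⟨j, hj, hj'⟩ := Int.exists_greatest_of_bdd (P := fun j => 0 ≤ lineFun N (g ^ (-j) • z))
    ⟨K, fun j hj => by
      by_contra! h
      obtain ⟨n, rfl⟩ := Int.eq_ofNat_of_zero_le ((Int.natCast_nonneg K).trans h.le)
      have h1 := mul_le_dist_pow_smul hN hn hδ n P (g ^ (-(n : ℤ)) • z) hP.le hj
      rw [← zpow_natCast, ← mul_smul, ← zpow_add, add_neg_cancel, zpow_zero, one_smul] at h1
      have h2 : (K : ℝ) ≤ n := by exact_mod_cast h.le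
      have := mul_le_mul_of_nonneg_right h2 hδ0.le
      linarith⟩
    ⟨-K, by
      by_contra! h
      rw [neg_neg, zpow_natCast] at h
      have h1 := mul_le_dist_pow_smul hN hn hδ K (g ^ K • z) P h.le hP.ge
      rw [dist_psl_smul, dist_comm] at h1
      linarith⟩
  refine ⟨j, hj, ?_⟩
  by_contra! h
  have e : g⁻¹ • g ^ (-j) • z = g ^ (-(j + 1)) • z := by
    rw [← mul_smul, ← zpow_neg_one, ← zpow_add, neg_add, add_comm]
  rw [e] at h
  have := hj' (j + 1) h
  linarith

lemma IsSimpleAxis.exists_dist_bound {G : Subgroup PSL(2, ℝ)} {α : PSL(2, ℝ)}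
    {N : Matrix (Fin 2) (Fin 2) ℝ} {u : ℝ} (S : IsSimpleAxis G α N u) {k : PSL(2, ℝ)} (hk : k ∈ G)
    (hdisj : ∀ z, lineFun N z = 0 → lineFun N (k⁻¹ • z) ≠ 0) :
    ∃ δ > 0, ∀ w v, lineFun N w = 0 → lineFun N (k⁻¹ • v) = 0 → δ ≤ dist w v := by
  have hs : 0 < 2 / Real.sinh u ^ 2 := by
    have := Real.sinh_pos_iff.mpr S.pos
    positivity
  refine ⟨Real.arsinh (Real.sqrt ((1 + 2 / Real.sinh u ^ 2) ^ 2 - 1)), ?_, fun w v hw hv => ?_⟩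
  · exact Real.arsinh_pos_iff.mpr (Real.sqrt_pos.mpr (by nlinarith))
  · have h := S.le_cosh_dist hk hdisj hw hv
    rw [← Real.sinh_le_sinh, Real.sinh_arsinh]
    refine Real.sqrt_le_iff.mpr ⟨Real.sinh_nonneg_iff.mpr dist_nonneg, ?_⟩
    rw [Real.sinh_sq (dist w v)]
    exact sub_le_sub_right (pow_le_pow_left₀ (by linarith) h 2) 1

/-- If the translates of the axes of `α` and `α₁` under `g` are pairwise disjoint, then the exponent
of `α` is bounded. -/
lemma IsSimpleAxis.cosh_bound {G : Subgroup PSL(2, ℝ)} {α : PSL(2, ℝ)}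
    {N N₁ : Matrix (Fin 2) (Fin 2) ℝ} {u L : ℝ} (S : IsSimpleAxis G α N u) (hN₁ : IsLine N₁)
    {g k : PSL(2, ℝ)} (hg : g ∈ G) (hk : k ∈ G)
    (hn : ∀ z, 0 ≤ lineFun N z → 0 < lineFun N (g • z))
    (hn₁ : ∀ z, 0 ≤ lineFun N₁ z → 0 < lineFun N₁ (g • z))
    (hkN : ∀ z, lineFun N₁ z = 0 ↔ lineFun N (k⁻¹ • z) = 0)
    (hdis : ∀ (j : ℤ) z, lineFun N₁ z = 0 → lineFun N (g ^ j • z) ≠ 0)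
    {P v P₁ w : ℍ} (hP : lineFun N P = 0) (hv : lineFun N v = 0) (hP₁ : lineFun N₁ P₁ = 0)
    (hw : lineFun N₁ w = 0) (hvP : dist v (g • P) ≤ L) (hwP : dist w (g • P₁) ≤ L) :
    2 / Real.sinh u ^ 2 * Real.cosh (dist P₁ w / 4) ^ 2 ≤ Real.sinh L ^ 2 := by
  obtain ⟨δ, hδ0, hδ⟩ := S.exists_dist_bound hg fun z hz hgz => by
    have := hn _ hgz.ge
    rw [smul_inv_smul, hz] at this
    exact lt_irrefl _ this
  obtain ⟨j, hj, hj'⟩ := exists_strip S.isLine hδ0 hn hδ hP P₁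
  obtain ⟨N₂, hN₂, hz₂⟩ := hN₁.exists_translate (g ^ j)
  have hsm : ∀ z : ℍ, g ^ j • g ^ (-j) • z = z := fun z => by
    rw [← mul_smul, ← zpow_add, add_neg_cancel, zpow_zero, one_smul]
  have hsm' : ∀ z : ℍ, g ^ (-j) • g ^ j • z = z := fun z => by
    rw [← mul_smul, ← zpow_add, neg_add_cancel, zpow_zero, one_smul]
  have hcomm : ∀ (i : ℤ) (z : ℍ), g ^ i • g • z = g • g ^ i • z := fun i z => by
    rw [← mul_smul, ← mul_smul, (Commute.zpow_self g i).eq]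
  have := S.strip_bound (L := L) (k := g ^ (-j) * k) (v := v) (P := P) (P₁ := g ^ (-j) • P₁)
    (w := g ^ (-j) • w) hN₂ hg (G.mul_mem (G.zpow_mem hg _) hk)
    (fun z hz => by
      rw [hz₂] at hz ⊢
      rw [hcomm]
      exact hn₁ _ hz)
    (fun z => by rw [hz₂, hkN, mul_inv_rev, ← zpow_neg, neg_neg, mul_smul])
    (fun z hz => by
      rw [hz₂] at hz
      have h1 := hdis (-j) _ hz
      have h2 := hdis (-1 + -j) _ hz
      rw [zpow_add, mul_smul, hsm', zpow_neg_one] at h2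
      rw [hsm'] at h1
      exact ⟨h1, h2⟩)
    hP hv (by rw [hz₂, hsm, hP₁]) (by rw [hz₂, hsm, hw]) hvP
    (by rwa [← hcomm, dist_psl_smul]) (lt_of_le_of_ne hj (hdis (-j) _ hP₁).symm) hj'
  rwa [dist_psl_smul] at this

/-- A lower bound for half the translation number of a simple closed geodesic that is crossed by a
closed geodesic of length at most `L`. -/
def halfLengthBound (L : ℝ) : ℝ := Real.arsinh (Real.sqrt (2 / (Real.cosh L - 1)))

lemma halfLengthBound_pos {L : ℝ} (hL : 0 < L) : 0 < halfLengthBound L := by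
  have := Real.one_lt_cosh.mpr hL.ne'
  exact Real.arsinh_pos_iff.mpr (Real.sqrt_pos.mpr (div_pos two_pos (by linarith)))

lemma IsSimpleAxis.halfLengthBound_le {G : Subgroup PSL(2, ℝ)} {α β : PSL(2, ℝ)}
    {N : Matrix (Fin 2) (Fin 2) ℝ} {u L : ℝ} (S : IsSimpleAxis G α N u) (hβ : β ∈ G) {P : ℍ}
    (hP : lineFun N P = 0) (hpos : 0 < lineFun N (β • P)) (hd : dist P (β • P) ≤ L) :
    halfLengthBound L ≤ u := by
  have hs := Real.sinh_pos_iff.mpr S.pos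
  have h := S.le_cosh_dist (x := P) (x' := β • P) hβ (fun z hz hβz => by
    have := S.pos_of_pos hβ hP hpos hβz
    rw [smul_inv_smul, hz] at this
    exact lt_irrefl _ this) hP (by rw [inv_smul_smul, hP])
  have h2 : Real.cosh (dist P (β • P)) ≤ Real.cosh L := by
    have := dist_nonneg (x := P) (y := β • P)
    rw [Real.cosh_le_cosh, abs_of_nonneg this, abs_of_nonneg (this.trans hd)]
    exact hd
  have h3 : 2 / Real.sinh u ^ 2 ≤ Real.cosh L - 1 := by linarith
  have h4 : 0 < 2 / Real.sinh u ^ 2 := by positivity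
  rw [← Real.sinh_le_sinh, halfLengthBound, Real.sinh_arsinh]
  refine Real.sqrt_le_iff.mpr ⟨hs.le, ?_⟩
  rw [div_le_iff₀ (by linarith)]
  rwa [div_le_iff₀ (by positivity), mul_comm] at h3

/-- A hyperbolic `β` whose axis crosses the axis of `α` moves the crossing point off the axis. -/
lemma IsSimpleAxis.exists_pos {G : Subgroup PSL(2, ℝ)} {α β : PSL(2, ℝ)}
    {N : Matrix (Fin 2) (Fin 2) ℝ} {u : ℝ} (S : IsSimpleAxis G α N u) (hh : IsHyperbolic β) {P : ℍ}
    (hP : axis α ∩ axis β = {P}) : ∃ N', IsSimpleAxis G α N' u ∧ 0 < lineFun N' (β • P) := by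
  have hPm : P ∈ axis α ∩ axis β := by rw [hP]; rfl
  rcases lt_trichotomy (lineFun N (β • P)) 0 with h | h | h
  · exact ⟨-N, S.neg, by rw [lineFun_neg]; linarith⟩
  · have : β • P ∈ axis α ∩ axis β := ⟨by rw [S.axis_eq]; exact h, hh.smul_mem_axis hPm.2⟩
    rw [hP, Set.mem_singleton_iff] at this
    have h2 := (hh.translationNumber_eq hPm.2).2
    rw [this, dist_self] at h2
    exact absurd h2 (lt_irrefl _)
  · exact ⟨N, S, h⟩

lemma exponent_le {L u : ℝ} (hu : 0 < u) (huL : 2 * u ≤ L) (hLu : halfLengthBound L ≤ u) {m : ℕ}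
    (h : 2 / Real.sinh u ^ 2 * Real.cosh (m * (2 * u) / 4) ^ 2 ≤ Real.sinh L ^ 2) :
    (m : ℝ) ≤ 2 * Real.sinh L ^ 2 * Real.sinh (L / 2) ^ 2 / halfLengthBound L ^ 2 := by
  have hL : 0 < L := by linarith
  have he := halfLengthBound_pos hL
  have hs := Real.sinh_pos_iff.mpr hu
  have hsL : Real.sinh u ≤ Real.sinh (L / 2) := Real.sinh_le_sinh.mpr (by linarith)
  have hm : (0 : ℝ) ≤ m := Nat.cast_nonneg m
  have hx : 0 ≤ m * u / 2 := by positivity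
  have hc : m * u / 2 ≤ Real.cosh (m * (2 * u) / 4) := by
    rw [show m * (2 * u) / 4 = m * u / 2 by ring]
    exact (Real.self_le_sinh_iff.mpr hx).trans (Real.sinh_lt_cosh _).le
  have hmm : (m : ℝ) ≤ m ^ 2 := by exact_mod_cast Nat.le_self_pow two_ne_zero m
  rw [le_div_iff₀ (by positivity)]
  have h1 : (m * u / 2) ^ 2 ≤ Real.cosh (m * (2 * u) / 4) ^ 2 := by gcongr
  have h2 : 2 * Real.cosh (m * (2 * u) / 4) ^ 2 ≤ Real.sinh L ^ 2 * Real.sinh u ^ 2 := by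
    rwa [div_mul_eq_mul_div, div_le_iff₀ (by positivity)] at h
  have h3 : Real.sinh L ^ 2 * Real.sinh u ^ 2 ≤ Real.sinh L ^ 2 * Real.sinh (L / 2) ^ 2 := by gcongr
  calc (m : ℝ) * halfLengthBound L ^ 2 ≤ m ^ 2 * u ^ 2 := by gcongr
    _ = 4 * (m * u / 2) ^ 2 := by ring
    _ ≤ _ := by linarith

end NonCancellation

end

open NonCancellation in
theorem mainTheorem3 (G : Subgroup PSL(2, ℝ)) (hG : NonCancellation.IsSurfaceGroup G)
    (L : ℝ) (hL : 0 < L) :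
    ∃ m₀ : ℕ, ∀ (α α₁ β β₁ : PSL(2, ℝ)) (P P₁ : ℍ),
      NonCancellation.IsSimpleClosedGeodesic G α →
      (∃ h ∈ G, α₁ = h * α * h⁻¹) →
      β ∈ G → NonCancellation.IsHyperbolic β →
      β₁ ∈ G → NonCancellation.IsHyperbolic β₁ →
      NonCancellation.axis α ∩ NonCancellation.axis β = {P} →
      NonCancellation.axis α₁ ∩ NonCancellation.axis β₁ = {P₁} →
      NonCancellation.translationNumber α ≤ L →
      NonCancellation.translationNumber β ≤ L →
      NonCancellation.translationNumber β₁ ≤ L →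
      ∀ m : ℕ, m₀ < m → α ^ m * β = α₁ ^ m * β₁ →
        (∃ n : ℤ, ∀ t : ℝ, NonCancellation.piecewiseGeodesic (α₁ ^ m) β₁ P₁ t =
          NonCancellation.piecewiseGeodesic (α ^ m) β P (t + n)) ∧
        ∃ u ∈ G, α₁ = u * α * u⁻¹ ∧ β₁ = u * β * u⁻¹ := by
  refine ⟨⌈2 * Real.sinh L ^ 2 * Real.sinh (L / 2) ^ 2 / halfLengthBound L ^ 2⌉₊, ?_⟩
  intro α α₁ β β₁ P P₁ hα hconj hβ hhβ hβ₁ hhβ₁ hP hP₁ hτα hτβ hτβ₁ m hm heq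
  obtain ⟨h, hh, hα₁⟩ := hconj
  have hPm : P ∈ axis α ∩ axis β := by rw [hP]; rfl
  have hPm₁ : P₁ ∈ axis α₁ ∩ axis β₁ := by rw [hP₁]; rfl
  have hαs₁ : IsSimpleClosedGeodesic G α₁ := hα₁ ▸ hα.conj hh
  obtain ⟨N₀, u, S₀⟩ := hα.exists_isSimpleAxis hG
  obtain ⟨N, S, hpos⟩ := S₀.exists_pos hhβ hP
  obtain ⟨M₀, u₁, T₀⟩ := hαs₁.exists_isSimpleAxis hG
  obtain ⟨N₁, T, hpos₁⟩ := T₀.exists_pos hhβ₁ hP₁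
  have hNP : lineFun N P = 0 := by have := hPm.1; rwa [S.axis_eq] at this
  have hNP₁ : lineFun N₁ P₁ = 0 := by have := hPm₁.1; rwa [T.axis_eq] at this
  have hkN : ∀ z, lineFun N₁ z = 0 ↔ lineFun N (h⁻¹ • z) = 0 := by
    intro z
    have h1 := smul_mem_axis_conj hα.2.1 h (h⁻¹ • z)
    rwa [smul_inv_smul, ← hα₁, T.axis_eq, S.axis_eq] at h1
  have hg : α ^ m * β ∈ G := G.mul_mem (G.pow_mem hα.1 m) hβ
  by_cases hmeet : ∃ (j : ℤ) (z : ℍ), lineFun N₁ z = 0 ∧ lineFun N ((α ^ m * β) ^ j • z) = 0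
  · obtain ⟨j, z, hz, hjz⟩ := hmeet
    obtain ⟨n, hn⟩ := S.stab ((α ^ m * β) ^ j * h) (G.mul_mem (G.zpow_mem hg j) hh) (h⁻¹ • z)
      ((hkN z).mp hz) (by rwa [mul_smul, smul_inv_smul])
    have hα₁' : α₁ = (α ^ m * β) ^ (-j) * α * ((α ^ m * β) ^ (-j))⁻¹ := by
      have e : h = (α ^ m * β) ^ (-j) * α ^ n := by rw [← hn, zpow_neg, inv_mul_cancel_left]
      calc α₁ = (α ^ m * β) ^ (-j) * (α ^ n * α * (α ^ n)⁻¹) * ((α ^ m * β) ^ (-j))⁻¹ := by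
            rw [hα₁, e]; group
        _ = _ := by rw [(Commute.zpow_self α n).eq, mul_inv_cancel_right]
    obtain ⟨h1, h2⟩ := conj_conclusion hα.2.1 hhβ hP hP₁ heq (-j) rfl hα₁'
    exact ⟨⟨-j, h1⟩, _, G.zpow_mem hg _, hα₁', h2⟩
  · exfalso
    push Not at hmeet
    have hdα := (hα.2.1.translationNumber_eq hPm.1).1
    have hdβ := (hhβ.translationNumber_eq hPm.2).1
    have hdβ₁ := (hhβ₁.translationNumber_eq hPm₁.2).1
    have hdu := S.dist_pow_smul 1 P hNP
    rw [pow_one, ← hdα, Nat.cast_one, one_mul] at hdu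
    have hdP₁ : dist P₁ (α₁ ^ m • P₁) = m * (2 * u) := by
      rw [← S.dist_pow_smul m (h⁻¹ • P₁) ((hkN P₁).mp hNP₁), hα₁, conj_pow, mul_smul, mul_smul,
        ← dist_psl_smul h (h⁻¹ • P₁), smul_inv_smul]
    have hb := S.cosh_bound (L := L) (v := α ^ m • P) (w := α₁ ^ m • P₁) T.isLine hg hh
      (S.nested hβ hhβ hNP hPm.2 hpos m) (heq ▸ T.nested hβ₁ hhβ₁ hNP₁ hPm₁.2 hpos₁ m) hkN hmeet
      hNP (by rw [S.lineFun_pow_smul, hNP]) hNP₁ (by rw [T.lineFun_pow_smul, hNP₁])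
      (by rw [mul_smul, dist_psl_smul, ← hdβ]; exact hτβ)
      (by rw [heq, mul_smul, dist_psl_smul, ← hdβ₁]; exact hτβ₁)
    rw [hdP₁] at hb
    have := exponent_le S.pos (by rw [← hdu]; exact hτα)
      (S.halfLengthBound_le hβ hNP hpos (by rw [← hdβ]; exact hτβ)) hb
    exact hm.not_ge (by exact_mod_cast this.trans (Nat.le_ceil _))
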